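/- Let $d\ge 1$ and $p\ge 1$, and let $\|\cdot\|$ be the Euclidean norm on $\mathbb{R}^d$. Let $S\subseteq\mathbb{N}$ be a set of sample sizes (for instance all $N\ge1$, or the powers of a base $b$), and for each $N\in S$ let $\{\boldsymbol u_1,\dots,\boldsymbol u_N\}$ be a randomized quasi-Monte Carlo (RQMC) point set: each $\boldsymbol u_i$ is uniformly distributed on $(0,1)^d$, and there is a deterministic constant $c$ such that, almost surely, for all $N\in S$ with $N\ge2$, $$D_N^*(\boldsymbol u_1,\dots,\boldsymbol u_N):=\sup_{\boldsymbol z\in(0,1)^d}\Big|\frac1N\sum_{i=1}^N \mathbf 1\{\boldsymbol u_i\in[\boldsymbol 0,\boldsymbol z)\}-\prod_{j=1}^d z_j\Big|\le c\,N^{-1}(\log N)^{d-1}.$$ For $j=1,\dots,d$ let $G_j$ be the CDF of a univariate distribution with density $g_j$, let $G_j^{-1}(v)=\inf\{t: G_j(t)\ge v\}$ for $0<v<1$, and let $G^{-1}(\boldsymbol u)=(G_1^{-1}(u_1),\dots,G_d^{-1}(u_d))$. Let $\boldsymbol X=G^{-1}(\boldsymbol u)$ with $\boldsymbol u$ uniform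 on $(0,1)^d$, and put $\pi(f)=\mathbb{E}f(\boldsymbol X)$ and $I_N(f)=\frac1N\sum_{i=1}^N f(G^{-1}(\boldsymbol u_i))$. Let $f:\mathbb{R}^d\to\mathbb{R}$ be continuous, let $M\in\mathbb{R}$, and suppose that for every multi-index $\boldsymbol a\in\mathbb{N}_0^d$ with $|\boldsymbol a|\le d$ the derivative $D^{\boldsymbol a}f=\partial^{|\boldsymbol a|}f/\partial x_1^{a_1}\cdots\partial x_d^{a_d}$ exists on $\mathbb{R}^d$ and there is a constant $c_{\boldsymbol a}$ with $|D^{\boldsymbol a}f(\boldsymbol x)|\le c_{\boldsymbol a}e^{M\|\boldsymbol x\|^2}$ for all $\boldsymbol x\in\mathbb{R}^d$. (i) If $M<0$, then for every $\epsilon>0$, $$\big\{\mathbb{E}|I_N(f)-\pi(f)|^p\big\}^{1/p}=\mathcal{O}(N^{-1+\epsilon}).$$ (ii) Suppose that there are constants $\alpha>0$, $\eta\in\mathbb{R}$, $t_0\ge0$ and $c'$ such that $\mathbb{P}(\|\boldsymbol X\|>t)\le c'\,t^{\eta}e^{-\alpha t^2}$ for all $t>t_0$, and that $0\le M<\alpha/p$.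 Then for every $\epsilon>0$, $$\big\{\mathbb{E}|I_N(f)-\pi(f)|^p\big\}^{1/p}=\mathcal{O}(N^{-\gamma+\epsilon}),\qquad \gamma=1-\frac{pM}{\alpha}.$$ If moreover $M<\alpha/(2p)$, then $\gamma>1/2$. In both parts $\pi(f)$ is an absolutely convergent integral, $\mathbb{E}|I_N(f)-\pi(f)|^p$ is finite, and $\mathcal{O}(N^s)$ means a bound $C N^s$ for all $N\in S$ with $N\ge1$, with $C$ not depending on $N$. -/

import Mathlib

open MeasureTheory ProbabilityTheory

namespace RQMC

noncomputable section

/-- The open unit cube `(0,1)^d`. -/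
def unitCube (d : ℕ) : Set (Fin d → ℝ) :=
  {u | ∀ j, u j ∈ Set.Ioo (0 : ℝ) 1}

/-- The uniform distribution `U(0,1)^d`. -/
def uniformCube (d : ℕ) : Measure (Fin d → ℝ) :=
  volume.restrict (unitCube d)

/-! ### Star discrepancy -/

open Classical in
/-- The local discrepancy at `z`: the fraction of the points `u₁, …, u_N` that lie in the box
`[0, z)`, minus the volume `∏ z_j` of the box. -/
def localDiscrepancy {d N : ℕ} (u : Fin N → Fin d → ℝ) (z : Fin d → ℝ) : ℝ :=
  (1 / (N : ℝ)) * ∑ i, (if ∀ j, 0 ≤ u i j ∧ u i j < z j then (1 : ℝ) else 0) - ∏ j, z j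

/-- The star discrepancy `D_N^*(u₁, …, u_N)`: the supremum over `z ∈ (0,1)^d` of the absolute
value of the local discrepancy at `z`. -/
def starDiscrepancy {d N : ℕ} (u : Fin N → Fin d → ℝ) : ℝ :=
  sSup ((fun z => |localDiscrepancy u z|) '' unitCube d)

/-! ### RQMC point sets -/

/-- A family `u N = (u N 1, …, u N N)`, `N ∈ S`, of RQMC point sets: every single point is
uniformly distributed on `(0,1)^d`, and almost surely the star discrepancy is
`O(N⁻¹ (log N)^(d-1))`, with a constant `c` that does not depend on the outcome. The bound is
required for `N ≥ 2` only because `log 1 = 0`. -/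
structure IsRQMCFamily {Ω : Type*} [MeasurableSpace Ω] (P : Measure Ω) {d : ℕ} (S : Set ℕ)
    (u : (N : ℕ) → Fin N → Ω → Fin d → ℝ) : Prop where
  uniform : ∀ N ∈ S, ∀ i, HasLaw (u N i) (uniformCube d) P
  lowDiscrepancy : ∃ c : ℝ, ∀ᵐ ω ∂P, ∀ N ∈ S, 2 ≤ N →
    starDiscrepancy (fun i => u N i ω) ≤ c * ((N : ℝ)⁻¹ * Real.log N ^ (d - 1))

/-! ### The inversion transformation -/

/-- `g` is a probability density on the real line. -/
structure IsDensity (g : ℝ → ℝ) : Prop where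
  nonneg : ∀ t, 0 ≤ g t
  integrable : Integrable g
  integral_eq_one : ∫ t, g t = 1

/-- The cumulative distribution function `G` of the distribution with density `g`. -/
def densityCDF (g : ℝ → ℝ) (t : ℝ) : ℝ :=
  ∫ s in Set.Iic t, g s

/-- The inverse CDF (quantile function) `G⁻¹(v) = inf {t : G(t) ≥ v}`, for `0 < v < 1`.
It is the ordinary inverse of `G` wherever `G` is injective. -/
def invCDF (g : ℝ → ℝ) (v : ℝ) : ℝ :=
  sInf {t | v ≤ densityCDF g t}

/-- The inversion transformation `G⁻¹(u) = (G₁⁻¹(u₁), …, G_d⁻¹(u_d))`, with values in `ℝ^d`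
with the Euclidean norm. -/
def invMap {d : ℕ} (g : Fin d → ℝ → ℝ) (u : Fin d → ℝ) : EuclideanSpace ℝ (Fin d) :=
  WithLp.toLp 2 (fun j => invCDF (g j) (u j))

/-! ### Growth and tail conditions -/

/-- The partial derivative `∂f/∂x_i`. -/
def partialDeriv {d : ℕ} (i : Fin d) (f : EuclideanSpace ℝ (Fin d) → ℝ) :
    EuclideanSpace ℝ (Fin d) → ℝ :=
  fun x => lineDeriv ℝ f x (EuclideanSpace.single i 1)

/-- `D^a f = ∂^|a| f / (∂x₁^{a₁} ⋯ ∂x_d^{a_d})`: differentiate `a_d` times in `x_d`, then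
`a_{d-1}` times in `x_{d-1}`, and so on, ending with `a₁` times in `x₁`. -/
def mixedDeriv {d : ℕ} (a : Fin d → ℕ) (f : EuclideanSpace ℝ (Fin d) → ℝ) :
    EuclideanSpace ℝ (Fin d) → ℝ :=
  (List.finRange d).foldr (fun i h => (partialDeriv i)^[a i] h) f

/-- `D^a f` exists on all of `ℝ^d`: each of the successive partial derivatives that lead
to `D^a f` exists at every point. -/
def MixedDerivExists {d : ℕ} (a : Fin d → ℕ) (f : EuclideanSpace ℝ (Fin d) → ℝ) : Prop :=
  ∀ i, ∀ k < a i, ∀ x, LineDifferentiableAt ℝ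
    (mixedDeriv (fun j => if j < i then 0 else if j = i then k else a j) f) x
    (EuclideanSpace.single i 1)

/-- `f` is continuous and, for every multi-index `a` with `|a| ≤ d`, the derivative `D^a f`
exists and satisfies `|D^a f(x)| ≲ exp(M ‖x‖²)` on `ℝ^d`. -/
structure HasGrowthRate {d : ℕ} (M : ℝ) (f : EuclideanSpace ℝ (Fin d) → ℝ) : Prop where
  continuous : Continuous f
  deriv_exists : ∀ a : Fin d → ℕ, ∑ i, a i ≤ d → MixedDerivExists a f
  bound : ∀ a : Fin d → ℕ, ∑ i, a i ≤ d →
    ∃ c : ℝ, ∀ x, |mixedDeriv a f x| ≤ c * Real.exp (M * ‖x‖ ^ 2)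

/-- The sub-Gaussian tail condition on `X = T(u)`, `u ∼ U(0,1)^d`, with parameters `α`, `η`:
there is a `t₀` with `ℙ(‖X‖ > t) ≲ t^η exp(-α t²)` for all `t > t₀`. -/
def SubGaussianTail {d : ℕ} (T : (Fin d → ℝ) → EuclideanSpace ℝ (Fin d)) (α η : ℝ) : Prop :=
  ∃ t₀ c : ℝ, 0 ≤ t₀ ∧ ∀ t > t₀,
    (uniformCube d).real {u | t < ‖T u‖} ≤ c * (t ^ η * Real.exp (-α * t ^ 2))

/-! ### The estimator and its error -/

/-- `π(f) = 𝔼 f(X)`, where `X = T(u)` with `u ∼ U(0,1)^d`. -/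
def targetMean {d : ℕ} (T : (Fin d → ℝ) → EuclideanSpace ℝ (Fin d))
    (f : EuclideanSpace ℝ (Fin d) → ℝ) : ℝ :=
  ∫ u, f (T u) ∂(uniformCube d)

/-- The estimator `I_N(f) = N⁻¹ ∑ f(T(u_i))`. -/
def estimator {d N : ℕ} (T : (Fin d → ℝ) → EuclideanSpace ℝ (Fin d))
    (f : EuclideanSpace ℝ (Fin d) → ℝ) (u : Fin N → Fin d → ℝ) : ℝ :=
  (1 / (N : ℝ)) * ∑ i, f (T (u i))

/-- The `L_p`-error is `O(N^s)`: `π(f)` is a convergent integral, and there is a constant `C`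
such that, for all `N ≥ 1` in `S`, the moment `𝔼 |I_N(f) - π(f)|^p` is finite and
`{𝔼 |I_N(f) - π(f)|^p}^(1/p) ≤ C N^s`. -/
def LpErrorIsBigO {Ω : Type*} [MeasurableSpace Ω] (P : Measure Ω) {d : ℕ} (S : Set ℕ)
    (u : (N : ℕ) → Fin N → Ω → Fin d → ℝ)
    (T : (Fin d → ℝ) → EuclideanSpace ℝ (Fin d))
    (f : EuclideanSpace ℝ (Fin d) → ℝ) (p s : ℝ) : Prop :=
  Integrable (fun v => f (T v)) (uniformCube d) ∧
  ∃ C : ℝ, ∀ N ∈ S, 1 ≤ N →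
    Integrable (fun ω => |estimator T f (fun i => u N i ω) - targetMean T f| ^ p) P ∧
    (∫ ω, |estimator T f (fun i => u N i ω) - targetMean T f| ^ p ∂P) ^ (1 / p)
      ≤ C * (N : ℝ) ^ s

end

end RQMC

/-!
The proof truncates `f` and applies a Koksma-Hlawka inequality to the truncated function.

Let `h x = f x * cutoff (‖x‖² - ρ)`, where the cutoff equals `1` on the ball of radius `√ρ` and
vanishes outside the ball of radius `√(ρ + 1)`. Since `h` has compact support, it is recovered
from its full mixed derivative `k = ∂₁ ⋯ ∂_d h` without boundary terms:
`h x = (-1)^d ∫_{y ≥ x} k y` (`eq_setIntegral_Ici_of_chain`). Only Fubini and the one-dimensional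
fundamental theorem of calculus enter, so `k` has to be bounded and measurable but not continuous.
Only derivatives of order at most one in each coordinate occur, and for these the Leibniz rule with
the radial cutoff is explicit (`cutoffDeriv`). It shows that `∫ |k|` is at most `exp (max M 0 * ρ)`
up to a polynomial in `ρ` (`HasGrowthRate.exists_truncation`).

As `G⁻¹(u) ≤ y` if and only if `u ≤ G(y)` (`IsDensity.invCDF_le_iff`), the error of the estimator
for `h` is, up to sign, the integral over `y` of `k y` times the discrepancy of the box `[0, G(y)]`.
Hence it is at most `D* ∫ |k|` (`koksma_hlawka_invMap`).

The remainder `f - h` is supported on `‖x‖² > ρ`. All points being uniformly distributed,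
Minkowski's inequality bounds its contribution by twice its `L^p` norm (`eLpNorm_error_le`). If `M = -τ < 0`,
this is `O(exp (-τ ρ))` by the growth condition. If `M ≥ 0`, the tail condition gives
`𝔼 exp (β ‖X‖²) < ∞` for every `β < α` (`SubGaussianTail.integrable_exp`), which makes it
`O(exp (-τ ρ))` with `τ = β / p - M`. In both cases `ρ = log N / (τ + max M 0)` balances the two
errors at `N ^ (-τ / (τ + max M 0))` (`lpErrorIsBigO_of_memLp`); the exponent is `-1` if `M < 0`,
and `-(1 - p M / β)` if `M ≥ 0`, where `β` may be taken arbitrarily close to `α`.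
-/

namespace RQMC

/-! ### The quantile function and the uniform distribution on the cube -/

/-- The distribution on the real line with density `g`. -/
noncomputable def densityMeasure (g : ℝ → ℝ) : Measure ℝ :=
  volume.withDensity (fun t => ENNReal.ofReal (g t))

section Quantile

variable {g : ℝ → ℝ}

theorem IsDensity.isProbabilityMeasure (hg : IsDensity g) :
    IsProbabilityMeasure (densityMeasure g) := by
  constructor
  rw [densityMeasure, withDensity_apply _ MeasurableSet.univ, Measure.restrict_univ,
    ← ofReal_integral_eq_lintegral_ofReal hg.integrable (ae_of_all _ hg.nonneg),
    hg.integral_eq_one, ENNReal.ofReal_one]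

theorem IsDensity.densityCDF_eq_cdf (hg : IsDensity g) :
    densityCDF g = cdf (densityMeasure g) := by
  have := hg.isProbabilityMeasure
  funext t
  rw [cdf_eq_real, Measure.real, densityMeasure, withDensity_apply _ measurableSet_Iic,
    densityCDF, integral_eq_lintegral_of_nonneg_ae (ae_of_all _ hg.nonneg)
      hg.integrable.aestronglyMeasurable.restrict]

theorem IsDensity.monotone_densityCDF (hg : IsDensity g) : Monotone (densityCDF g) := by
  rw [hg.densityCDF_eq_cdf]; exact monotone_cdf _

theorem IsDensity.densityCDF_nonneg (hg : IsDensity g) (t : ℝ) : 0 ≤ densityCDF g t := by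
  rw [hg.densityCDF_eq_cdf]; exact cdf_nonneg _ t

theorem IsDensity.densityCDF_le_one (hg : IsDensity g) (t : ℝ) : densityCDF g t ≤ 1 := by
  rw [hg.densityCDF_eq_cdf]; exact cdf_le_one _ t

/-- The Galois connection between the quantile function and the distribution function. -/
theorem IsDensity.invCDF_le_iff (hg : IsDensity g) {v : ℝ} (hv : v ∈ Set.Ioo (0 : ℝ) 1) (t : ℝ) :
    invCDF g v ≤ t ↔ v ≤ densityCDF g t := by
  have hmono := hg.monotone_densityCDF
  have hbot : BddBelow {t | v ≤ densityCDF g t} := by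
    have h := tendsto_cdf_atBot (densityMeasure g)
    rw [← hg.densityCDF_eq_cdf] at h
    obtain ⟨a, ha⟩ := (h.eventually (gt_mem_nhds hv.1)).exists
    refine ⟨a, fun s hs => ?_⟩
    by_contra! hlt
    exact absurd (hs.trans (hmono hlt.le)) (not_le.mpr ha)
  have hne : {t | v ≤ densityCDF g t}.Nonempty := by
    have h := tendsto_cdf_atTop (densityMeasure g)
    rw [← hg.densityCDF_eq_cdf] at h
    obtain ⟨a, ha⟩ := (h.eventually (lt_mem_nhds hv.2)).exists
    exact ⟨a, ha.le⟩
  refine ⟨fun h => ?_, fun h => csInf_le hbot h⟩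
  -- Right continuity puts the infimum itself into the set.
  have hcont : ContinuousWithinAt (densityCDF g) (Set.Ioi t) t := by
    have := (cdf (densityMeasure g)).right_continuous t
    rw [← hg.densityCDF_eq_cdf] at this
    exact this.mono Set.Ioi_subset_Ici_self
  refine ge_of_tendsto hcont ?_
  filter_upwards [self_mem_nhdsWithin] with s hs
  obtain ⟨r, hr, hrs⟩ := exists_lt_of_csInf_lt hne (lt_of_le_of_lt h hs)
  exact le_trans hr (hmono hrs.le)

theorem IsDensity.monotoneOn_invCDF (hg : IsDensity g) :
    MonotoneOn (invCDF g) (Set.Ioo 0 1) := fun _ hv _ hw hvw =>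
  (hg.invCDF_le_iff hv _).2 (hvw.trans ((hg.invCDF_le_iff hw _).1 le_rfl))

end Quantile

theorem uniformCube_eq_pi (d : ℕ) :
    uniformCube d = Measure.pi (fun _ => volume.restrict (Set.Ioo (0 : ℝ) 1)) := by
  rw [← Measure.restrict_pi_pi, uniformCube, ← volume_pi]
  congr 1
  ext u
  simp [unitCube]

instance (d : ℕ) : IsProbabilityMeasure (uniformCube d) := by
  have : IsProbabilityMeasure (volume.restrict (Set.Ioo (0 : ℝ) 1)) := ⟨by simp⟩
  rw [uniformCube_eq_pi]
  infer_instance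

theorem measurableSet_unitCube (d : ℕ) : MeasurableSet (unitCube d) := by
  have : unitCube d = Set.univ.pi fun _ => Set.Ioo (0 : ℝ) 1 := by ext u; simp [unitCube]
  rw [this]
  exact MeasurableSet.univ_pi fun _ => measurableSet_Ioo

theorem ae_mem_unitCube (d : ℕ) : ∀ᵐ v ∂(uniformCube d), v ∈ unitCube d :=
  ae_restrict_mem (measurableSet_unitCube d)

theorem uniformCube_real_Iic {d : ℕ} {z : Fin d → ℝ} (h0 : ∀ j, 0 ≤ z j) (h1 : ∀ j, z j ≤ 1) :
    (uniformCube d).real (Set.Iic z) = ∏ j, z j := by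
  have key : ∀ j, (volume.restrict (Set.Ioo (0 : ℝ) 1)) (Set.Iic (z j)) =
      ENNReal.ofReal (z j) := by
    intro j
    rw [Measure.restrict_congr_set Ioo_ae_eq_Ioc, Measure.restrict_apply measurableSet_Iic,
      Set.inter_comm, Set.Ioc_inter_Iic, min_eq_right (h1 j), Real.volume_Ioc, sub_zero]
  rw [Measure.real, uniformCube_eq_pi, ← Set.pi_univ_Iic, Measure.pi_pi, Finset.prod_congr rfl
    (fun j _ => key j), ENNReal.toReal_prod]
  exact Finset.prod_congr rfl fun j _ => ENNReal.toReal_ofReal (h0 j)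

theorem aemeasurable_invMap {d : ℕ} {g : Fin d → ℝ → ℝ} (hg : ∀ j, IsDensity (g j)) :
    AEMeasurable (invMap g) (uniformCube d) := by
  refine (WithLp.measurable_toLp 2 (Fin d → ℝ)).comp_aemeasurable
    (aemeasurable_pi_lambda _ fun j => ?_)
  rw [uniformCube_eq_pi]
  exact (aemeasurable_restrict_of_monotoneOn measurableSet_Ioo
    (hg j).monotoneOn_invCDF).comp_quasiMeasurePreserving
      (Measure.quasiMeasurePreserving_eval (fun _ : Fin d => volume.restrict (Set.Ioo (0 : ℝ) 1)) j)

/-! ### Compactly supported functions as integrals of their mixed derivative -/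

/-- A measurable function on `ℝⁿ` that is bounded and vanishes outside of a bounded cube. -/
structure IsBoundedCompact {n : ℕ} (F : (Fin n → ℝ) → ℝ) : Prop where
  measurable : Measurable F
  bounded : ∃ B, ∀ x, |F x| ≤ B
  support : ∃ B, ∀ x, (∃ j, B < |x j|) → F x = 0

theorem IsBoundedCompact.integrable {n : ℕ} {F : (Fin n → ℝ) → ℝ} (hF : IsBoundedCompact F) :
    Integrable F := by
  obtain ⟨B, hB⟩ := hF.bounded
  obtain ⟨R, hR⟩ := hF.support
  have hsupp : F.support ⊆ Set.univ.pi fun _ => Set.Icc (-R) R := by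
    intro x hx j _
    by_contra hj
    refine hx (hR x ⟨j, ?_⟩)
    rw [Set.mem_Icc, ← abs_le] at hj
    exact not_le.mp hj
  rw [← integrableOn_iff_integrable_of_support_subset hsupp]
  have hfin : volume (Set.univ.pi fun _ : Fin n => Set.Icc (-R) R) ≠ ⊤ :=
    (isCompact_univ_pi fun _ => isCompact_Icc).measure_lt_top.ne
  exact IntegrableOn.of_bound hfin.lt_top hF.measurable.aestronglyMeasurable B (ae_of_all _ hB)

theorem IsBoundedCompact.section_tail {n : ℕ} {F : (Fin (n + 1) → ℝ) → ℝ}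
    (hF : IsBoundedCompact F) (a : ℝ) :
    IsBoundedCompact fun y : Fin n → ℝ => F (Fin.cons a y) := by
  obtain ⟨B, hB⟩ := hF.bounded
  obtain ⟨R, hR⟩ := hF.support
  refine ⟨hF.measurable.comp ?_, ⟨B, fun y => hB _⟩,
    ⟨R, fun y ⟨j, hj⟩ => hR _ ⟨j.succ, by simpa using hj⟩⟩⟩
  refine measurable_pi_lambda _ fun j => ?_
  refine Fin.cases ?_ (fun j => ?_) j <;> (simp; try fun_prop)

theorem measurable_cons_left {n : ℕ} (y : Fin n → ℝ) :
    Measurable fun t : ℝ => (Fin.cons t y : Fin (n + 1) → ℝ) := by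
  refine measurable_pi_lambda _ fun j => ?_
  refine Fin.cases ?_ (fun j => ?_) j
  · simpa using measurable_id'
  · simp

theorem IsBoundedCompact.integrable_section_head {n : ℕ} {F : (Fin (n + 1) → ℝ) → ℝ}
    (hF : IsBoundedCompact F) (y : Fin n → ℝ) :
    Integrable fun t : ℝ => F (Fin.cons t y) := by
  obtain ⟨B, hB⟩ := hF.bounded
  obtain ⟨R, hR⟩ := hF.support
  have hsupp : (fun t : ℝ => F (Fin.cons t y)).support ⊆ Set.Icc (-R) R := by
    intro t ht
    by_contra hj
    refine ht (hR _ ⟨0, ?_⟩)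
    rw [Set.mem_Icc, ← abs_le] at hj
    simpa using not_le.mp hj
  rw [← integrableOn_iff_integrable_of_support_subset hsupp]
  exact IntegrableOn.of_bound (by simp)
    (hF.measurable.comp (measurable_cons_left y)).aestronglyMeasurable B (ae_of_all _ fun t => hB _)

/-- Fubini over an upper orthant of `ℝⁿ⁺¹`, with the first coordinate integrated innermost. -/
theorem setIntegral_Ici_cons {n : ℕ} {F : (Fin (n + 1) → ℝ) → ℝ} (hF : Integrable F)
    (a : ℝ) (x : Fin n → ℝ) :
    ∫ y in Set.Ici (Fin.cons a x : Fin (n + 1) → ℝ), F y =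
      ∫ y in Set.Ici x, ∫ t in Set.Ioi a, F (Fin.cons t y) := by
  have hmp := (volume_preserving_piFinSuccAbove (fun _ : Fin (n + 1) => ℝ) 0).symm
  have hset : (MeasurableEquiv.piFinSuccAbove (fun _ : Fin (n + 1) => ℝ) 0).symm ⁻¹'
      Set.Ici (Fin.cons a x : Fin (n + 1) → ℝ) = Set.Ici a ×ˢ Set.Ici x := by
    ext ⟨t, y⟩
    simp [MeasurableEquiv.piFinSuccAbove, Fin.insertNthEquiv, Fin.cons_le_cons]
  have hval : ∀ z : ℝ × (Fin n → ℝ),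
      (MeasurableEquiv.piFinSuccAbove (fun _ : Fin (n + 1) => ℝ) 0).symm z = Fin.cons z.1 z.2 := by
    rintro ⟨t, y⟩
    simp [MeasurableEquiv.piFinSuccAbove, Fin.insertNthEquiv]
  rw [← hmp.setIntegral_preimage_emb (MeasurableEquiv.measurableEmbedding _) F, hset]
  have hint : Integrable (fun z : ℝ × (Fin n → ℝ) => F (Fin.cons z.1 z.2))
      (volume.prod volume) := by
    have := (hmp.integrable_comp_emb (MeasurableEquiv.measurableEmbedding _)).2 hF
    simp only [Function.comp_def, hval] at this
    exact this
  simp only [hval]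
  rw [show (volume : Measure (ℝ × (Fin n → ℝ))) = volume.prod volume from rfl,
    ← Measure.prod_restrict]
  rw [integral_prod_symm]
  · simp only [integral_Ici_eq_integral_Ioi]
  · rw [Measure.prod_restrict]; exact hint.restrict

/-- If `F m` arises from `F (m + 1)` by differentiation in the `m`-th coordinate, so that `F 0` is
the full mixed derivative of `F n`, and all functions have compact support, then `F n` is recovered
by integrating `F 0` over upper orthants. Compact support removes all the boundary terms that
occur in the Hardy-Krause formula. -/
theorem eq_setIntegral_Ici_of_chain {n : ℕ} (F : Fin (n + 1) → (Fin n → ℝ) → ℝ)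
    (hF : ∀ m, IsBoundedCompact (F m))
    (hderiv : ∀ (m : Fin n) (x : Fin n → ℝ),
      HasDerivAt (fun t => F m.succ (Function.update x m t)) (F m.castSucc x) (x m))
    (x : Fin n → ℝ) :
    F (Fin.last n) x = (-1) ^ n * ∫ y in Set.Ici x, F 0 y := by
  induction n with
  | zero =>
    have : Set.Ici x = {x} := by ext y; simp [Subsingleton.elim y x]
    rw [this]
    simp [Measure.volume_pi_eq_dirac x]
  | succ n ih =>
    obtain ⟨a, x, rfl⟩ : ∃ a y, x = Fin.cons a y := ⟨x 0, Fin.tail x, by simp⟩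
    have step : ∀ y : Fin n → ℝ, F 1 (Fin.cons a y) =
        - ∫ t in Set.Ioi a, F 0 (Fin.cons t y) := by
      intro y
      obtain ⟨R, hR⟩ := (hF 1).support
      have h := integral_Ioi_of_hasDerivAt_of_tendsto' (a := a) (m := 0)
        (f := fun t => F 1 (Fin.cons t y)) (f' := fun t => F 0 (Fin.cons t y))
        (fun t _ => by simpa using hderiv 0 (Fin.cons t y))
        ((hF 0).integrable_section_head y).integrableOn ?_
      · rw [h]; ring
      · refine tendsto_const_nhds.congr' ?_
        filter_upwards [Filter.eventually_gt_atTop R] with t ht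
        exact (hR _ ⟨0, by simpa using ht.trans_le (le_abs_self t)⟩).symm
    have h := ih (fun m y => F m.succ (Fin.cons a y)) (fun m => (hF _).section_tail a)
      (fun m y => by
        have := hderiv m.succ (Fin.cons a y)
        simpa only [← Fin.cons_update, Fin.cons_succ, Fin.castSucc_succ,
          ← Fin.succ_castSucc] using this) x
    rw [setIntegral_Ici_cons (hF 0).integrable, ← Fin.succ_last, h]
    simp only [Fin.succ_zero_eq_one, step, integral_neg]
    ring

/-! ### A Koksma-Hlawka inequality for the transformed points -/

theorem abs_localDiscrepancy_le {d N : ℕ} (v : Fin N → Fin d → ℝ) {z : Fin d → ℝ}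
    (hz : z ∈ unitCube d) : |localDiscrepancy v z| ≤ starDiscrepancy v := by
  refine le_csSup ⟨2, ?_⟩ ⟨z, hz, rfl⟩
  rintro _ ⟨w, hw, rfl⟩
  have h1 : |∏ j, w j| ≤ 1 := by
    rw [Finset.abs_prod]
    exact Finset.prod_le_one (fun j _ => abs_nonneg _)
      fun j _ => abs_le.2 ⟨by linarith [(hw j).1], (hw j).2.le⟩
  have h2 : ∀ c : Fin N → ℝ, (∀ i, |c i| ≤ 1) → |(1 / (N : ℝ)) * ∑ i, c i| ≤ 1 := by
    intro c hc
    rw [abs_mul, abs_of_nonneg (by positivity), one_div]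
    refine inv_mul_le_one_of_le₀ ?_ (by positivity)
    calc |∑ i, c i| ≤ ∑ i, |c i| := Finset.abs_sum_le_sum_abs _ _
      _ ≤ ∑ _i : Fin N, 1 := Finset.sum_le_sum fun i _ => hc i
      _ = N := by simp
  refine (abs_sub _ _).trans ?_
  have := h2 (fun i => open Classical in if ∀ j, 0 ≤ v i j ∧ v i j < w j then (1 : ℝ) else 0)
    (fun i => by split_ifs <;> simp)
  linarith

/-- The star discrepancy also controls closed boxes, by approximating them with slightly larger
half-open ones (slightly smaller ones in the directions where `z j = 1`). -/
theorem abs_closed_discrepancy_le {d N : ℕ} (v : Fin N → Fin d → ℝ) (hv : ∀ i, v i ∈ unitCube d)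
    {z : Fin d → ℝ} (h0 : ∀ j, 0 ≤ z j) (h1 : ∀ j, z j ≤ 1) :
    |(1 / (N : ℝ)) * ∑ i, (Set.Iic z).indicator 1 (v i) - ∏ j, z j| ≤ starDiscrepancy v := by
  classical
  let w : ℝ → Fin d → ℝ := fun t j => if z j < 1 then z j + t * (1 - z j) else 1 - t
  have hw : ∀ t ∈ Set.Ioo (0 : ℝ) 1, w t ∈ unitCube d := by
    rintro t ⟨ht0, ht1⟩ j
    simp only [w]
    split_ifs with h
    · have := h0 j
      constructor <;> nlinarith
    · constructor <;> linarith
  have hwz : Filter.Tendsto w (nhdsWithin 0 (Set.Ioi 0)) (nhds z) := by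
    refine tendsto_pi_nhds.2 fun j => ?_
    have hc : Continuous fun t : ℝ => w t j := by
      simp only [w]; split_ifs <;> fun_prop
    have := (hc.tendsto 0).mono_left (nhdsWithin_le_nhds (s := Set.Ioi 0))
    convert this using 2
    simp only [w]
    split_ifs with h
    · simp
    · linarith [h1 j]
  have hiff : ∀ i, ∀ᶠ t in nhdsWithin (0 : ℝ) (Set.Ioi 0),
      ((∀ j, 0 ≤ v i j ∧ v i j < w t j) ↔ v i ≤ z) := by
    intro i
    have hj : ∀ j, ∀ᶠ t in nhdsWithin (0 : ℝ) (Set.Ioi 0), (v i j < w t j ↔ v i j ≤ z j) := by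
      intro j
      rcases lt_or_ge (z j) 1 with h | h
      · rcases le_or_gt (v i j) (z j) with h' | h'
        · filter_upwards [self_mem_nhdsWithin] with t (ht : 0 < t)
          simp only [w, h, if_true, h', iff_true]
          nlinarith
        · have := (tendsto_pi_nhds.1 hwz j).eventually (gt_mem_nhds h')
          filter_upwards [this] with t ht
          simp only [h'.not_ge, iff_false, not_lt]
          exact ht.le
      · have hlt : v i j < z j := (hv i j).2.trans_le h
        have := (tendsto_pi_nhds.1 hwz j).eventually (lt_mem_nhds hlt)
        filter_upwards [this] with t ht
        simp [ht, hlt.le]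
    filter_upwards [Filter.eventually_all.2 hj] with t ht
    exact ⟨fun h j => (ht j).1 (h j).2, fun h j => ⟨(hv i j).1.le, (ht j).2 (h j)⟩⟩
  have hlim : Filter.Tendsto (fun t => |localDiscrepancy v (w t)|) (nhdsWithin 0 (Set.Ioi 0))
      (nhds |(1 / (N : ℝ)) * ∑ i, (Set.Iic z).indicator 1 (v i) - ∏ j, z j|) := by
    refine Filter.Tendsto.abs (Filter.Tendsto.sub ?_ ?_)
    · refine tendsto_const_nhds.congr' ?_
      filter_upwards [Filter.eventually_all.2 hiff] with t ht
      congr 1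
      refine Finset.sum_congr rfl fun i _ => ?_
      simp only [Set.indicator_apply, Set.mem_Iic, Pi.one_apply, ← ht i]
    · exact tendsto_finsetProd _ fun j _ => tendsto_pi_nhds.1 hwz j
  refine le_of_tendsto hlim ?_
  filter_upwards [Ioo_mem_nhdsGT (zero_lt_one' ℝ)] with t ht
  exact abs_localDiscrepancy_le v (hw t ht)

/-- Koksma-Hlawka inequality for the composition of the inversion transformation with a function
that is the integral of `k` over upper orthants. Inversion turns orthants of `ℝᵈ` into boxes
anchored at the origin. -/
theorem koksma_hlawka_invMap {d N : ℕ} {g : Fin d → ℝ → ℝ} (hg : ∀ j, IsDensity (g j))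
    {h : EuclideanSpace ℝ (Fin d) → ℝ} {k : (Fin d → ℝ) → ℝ} (hk : Integrable k)
    (s : ℝ) (hs : |s| = 1)
    (hh : ∀ x, h (WithLp.toLp 2 x) = s * ∫ y in Set.Ici x, k y)
    (v : Fin N → Fin d → ℝ) (hv : ∀ i, v i ∈ unitCube d) :
    |estimator (invMap g) h v - targetMean (invMap g) h| ≤ starDiscrepancy v * ∫ y, |k y| := by
  classical
  let G : (Fin d → ℝ) → Fin d → ℝ := fun y j => densityCDF (g j) (y j)
  have hG : Measurable G := measurable_pi_lambda _ fun j =>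
    (hg j).monotone_densityCDF.measurable.comp (measurable_pi_apply j)
  have hcomp : ∀ w ∈ unitCube d, h (invMap g w) =
      s * ∫ y, (Set.Iic (G y)).indicator 1 w * k y := by
    intro w hw
    rw [invMap, hh, ← integral_indicator measurableSet_Ici]
    congr 2
    funext y
    have : (fun j => invCDF (g j) (w j)) ≤ y ↔ w ≤ G y :=
      forall_congr' fun j => (hg j).invCDF_le_iff (hw j) _
    simp only [Set.indicator_apply, Set.mem_Ici, Set.mem_Iic, this, Pi.one_apply]
    split_ifs <;> simp
  have hset : MeasurableSet {q : (Fin d → ℝ) × (Fin d → ℝ) | q.1 ≤ G q.2} :=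
    measurableSet_le measurable_fst (hG.comp measurable_snd)
  have hmeas : Measurable fun q : (Fin d → ℝ) × (Fin d → ℝ) =>
      (Set.Iic (G q.2)).indicator (1 : (Fin d → ℝ) → ℝ) q.1 :=
    (measurable_const (a := (1 : ℝ))).indicator hset
  have hbdd : ∀ (w z : Fin d → ℝ), ‖(Set.Iic z).indicator (1 : (Fin d → ℝ) → ℝ) w‖ ≤ 1 := by
    intro w z
    rw [Set.indicator_apply]; split_ifs <;> simp
  have hint : ∀ w, Integrable fun y => (Set.Iic (G y)).indicator 1 w * k y := fun w =>
    hk.bdd_mul (hmeas.comp measurable_prodMk_left).aestronglyMeasurable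
      (ae_of_all _ fun y => hbdd _ _)
  have hest : estimator (invMap g) h v =
      s * ∫ y, ((1 / (N : ℝ)) * ∑ i, (Set.Iic (G y)).indicator 1 (v i)) * k y := by
    have e : ∀ y, ((1 / (N : ℝ)) * ∑ i, (Set.Iic (G y)).indicator 1 (v i)) * k y =
        (1 / (N : ℝ)) * ∑ i, (Set.Iic (G y)).indicator 1 (v i) * k y := fun y => by
      rw [mul_assoc, Finset.sum_mul]
    simp only [e]
    rw [integral_const_mul, integral_finsetSum _ fun i _ => hint _, estimator,
      Finset.sum_congr rfl fun i _ => hcomp _ (hv i), ← Finset.mul_sum]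
    ring
  have htar : targetMean (invMap g) h = s * ∫ y, (∏ j, G y j) * k y := by
    have hprod : Integrable (fun q : (Fin d → ℝ) × (Fin d → ℝ) =>
        (Set.Iic (G q.2)).indicator 1 q.1 * k q.2) ((uniformCube d).prod volume) :=
      (hk.comp_snd (uniformCube d)).bdd_mul hmeas.aestronglyMeasurable
        (ae_of_all _ fun y => hbdd _ _)
    rw [targetMean, integral_congr_ae ((ae_mem_unitCube d).mono hcomp), integral_const_mul,
      integral_integral_swap hprod]
    congr 2
    funext y
    rw [integral_mul_const, integral_indicator_one measurableSet_Iic,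
      uniformCube_real_Iic (fun j => (hg j).densityCDF_nonneg _)
        (fun j => (hg j).densityCDF_le_one _)]
  have hint1 : Integrable fun y =>
      ((1 / (N : ℝ)) * ∑ i, (Set.Iic (G y)).indicator 1 (v i)) * k y := by
    have e : ∀ y, ((1 / (N : ℝ)) * ∑ i, (Set.Iic (G y)).indicator 1 (v i)) * k y =
        (1 / (N : ℝ)) * ∑ i, (Set.Iic (G y)).indicator 1 (v i) * k y := fun y => by
      rw [mul_assoc, Finset.sum_mul]
    simp only [e]
    exact (integrable_finsetSum _ fun i _ => hint _).const_mul _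
  have hint2 : Integrable fun y => (∏ j, G y j) * k y := by
    refine hk.bdd_mul (c := 1) (Finset.measurable_prod _ fun j _ =>
      (measurable_pi_apply j).comp hG).aestronglyMeasurable (ae_of_all _ fun y => ?_)
    rw [norm_prod]
    refine Finset.prod_le_one (fun j _ => norm_nonneg _) fun j _ => ?_
    rw [Real.norm_of_nonneg ((hg j).densityCDF_nonneg _)]
    exact (hg j).densityCDF_le_one _
  rw [hest, htar, ← mul_sub, ← integral_sub hint1 hint2, abs_mul, hs, one_mul,
    ← integral_const_mul, ← Real.norm_eq_abs]
  refine norm_integral_le_of_norm_le (hk.abs.const_mul _) (ae_of_all _ fun y => ?_)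
  rw [← sub_mul, norm_mul, Real.norm_eq_abs, Real.norm_eq_abs]
  exact mul_le_mul_of_nonneg_right (abs_closed_discrepancy_le v hv
    (fun j => (hg j).densityCDF_nonneg _) (fun j => (hg j).densityCDF_le_one _)) (abs_nonneg _)

/-! ### Square-free mixed derivatives -/

/-- The multi-index with entry `1` on `A` and `0` elsewhere. -/
def sqfreeIndex {d : ℕ} (A : Finset (Fin d)) : Fin d → ℕ := fun j => if j ∈ A then 1 else 0

theorem sum_sqfreeIndex_le {d : ℕ} (A : Finset (Fin d)) : ∑ j, sqfreeIndex A j ≤ d := by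
  simpa [sqfreeIndex] using A.card_le_univ

theorem mixedDeriv_sqfreeIndex_empty {d : ℕ} (f : EuclideanSpace ℝ (Fin d) → ℝ) :
    mixedDeriv (sqfreeIndex ∅) f = f := by
  simp [mixedDeriv, sqfreeIndex]

theorem mixedDeriv_sqfreeIndex_insert {d : ℕ} (f : EuclideanSpace ℝ (Fin d) → ℝ)
    {i : Fin d} {A : Finset (Fin d)} (hi : ∀ j ∈ A, i < j) :
    mixedDeriv (sqfreeIndex (insert i A)) f = partialDeriv i (mixedDeriv (sqfreeIndex A) f) := by
  unfold mixedDeriv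
  have hiA : i ∉ A := fun h => lt_irrefl i (hi i h)
  have key : ∀ L : List (Fin d), L.Pairwise (· < ·) → i ∈ L →
      L.foldr (fun j h => (partialDeriv j)^[sqfreeIndex (insert i A) j] h) f =
        partialDeriv i (L.foldr (fun j h => (partialDeriv j)^[sqfreeIndex A j] h) f) := by
    intro L hL hiL
    induction L with
    | nil => simp at hiL
    | cons l L ih =>
      rw [List.pairwise_cons] at hL
      rcases eq_or_ne l i with rfl | hne
      · have h : L.foldr (fun j h => (partialDeriv j)^[sqfreeIndex (insert l A) j] h) f =
            L.foldr (fun j h => (partialDeriv j)^[sqfreeIndex A j] h) f := by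
          refine List.foldr_ext _ _ _ fun j hj h => ?_
          have : j ≠ l := (hL.1 j hj).ne'
          simp [sqfreeIndex, this]
        rw [List.foldr_cons, List.foldr_cons, h]
        simp [sqfreeIndex, hiA]
      · have hiL' : i ∈ L := (List.mem_cons.1 hiL).resolve_left (Ne.symm hne)
        have hlA : l ∉ A := fun h => lt_asymm (hi l h) (hL.1 i hiL')
        rw [List.foldr_cons, List.foldr_cons, ih hL.2 hiL']
        simp [sqfreeIndex, hlA, hne]
  exact key _ (List.pairwise_lt_finRange d) (List.mem_finRange i)

section HasGrowthRate

variable {d : ℕ} {M : ℝ} {f : EuclideanSpace ℝ (Fin d) → ℝ}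

theorem HasGrowthRate.hasLineDerivAt (hf : HasGrowthRate M f) {i : Fin d} {A : Finset (Fin d)}
    (hi : ∀ j ∈ A, i < j) (x : EuclideanSpace ℝ (Fin d)) :
    HasLineDerivAt ℝ (mixedDeriv (sqfreeIndex A) f)
      (mixedDeriv (sqfreeIndex (insert i A)) f x) x (EuclideanSpace.single i 1) := by
  have h := hf.deriv_exists (sqfreeIndex (insert i A)) (sum_sqfreeIndex_le _) i 0
    (by simp [sqfreeIndex]) x
  have e : (fun j => if j < i then 0 else if j = i then 0 else sqfreeIndex (insert i A) j) =
      sqfreeIndex A := by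
    funext j
    rcases lt_trichotomy j i with hj | rfl | hj
    · have : j ∉ A := fun hA => lt_asymm hj (hi j hA)
      simp [sqfreeIndex, hj, this]
    · have : j ∉ A := fun hA => lt_irrefl j (hi j hA)
      simp [sqfreeIndex, this]
    · simp [sqfreeIndex, hj.ne', hj.not_gt]
  rw [e] at h
  rw [mixedDeriv_sqfreeIndex_insert f hi]
  exact h.hasLineDerivAt

/-- The mixed derivatives are pointwise limits of difference quotients, so they are measurable
although they need not be continuous. -/
theorem HasGrowthRate.measurable_mixedDeriv (hf : HasGrowthRate M f) (A : Finset (Fin d)) :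
    Measurable (mixedDeriv (sqfreeIndex A) f) := by
  induction A using Finset.induction_on_min with
  | empty => rw [mixedDeriv_sqfreeIndex_empty]; exact hf.continuous.measurable
  | insert i A hi ih =>
    have hlim : Filter.Tendsto (fun n : ℕ => (1 / ((n : ℝ) + 1))) Filter.atTop
        (nhdsWithin 0 {0}ᶜ) :=
      tendsto_nhdsWithin_iff.2 ⟨tendsto_one_div_add_atTop_nhds_zero_nat,
        Filter.Eventually.of_forall fun n => by
          simp only [Set.mem_compl_iff, Set.mem_singleton_iff]; positivity⟩
    refine measurable_of_tendsto_metrizable (fun n => ?_) (tendsto_pi_nhds.2 fun x =>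
      (hf.hasLineDerivAt hi x).tendsto_slope_zero.comp hlim)
    have h : Measurable fun x => mixedDeriv (sqfreeIndex A) f
        (x + (1 / ((n : ℝ) + 1)) • EuclideanSpace.single i (1 : ℝ)) :=
      ih.comp (measurable_id.add_const _)
    exact (h.sub ih).const_smul (1 / ((n : ℝ) + 1))⁻¹

theorem HasGrowthRate.hasDerivAt_update (hf : HasGrowthRate M f) {i : Fin d}
    {A : Finset (Fin d)} (hi : ∀ j ∈ A, i < j) (x : Fin d → ℝ) :
    HasDerivAt (fun t => mixedDeriv (sqfreeIndex A) f (WithLp.toLp 2 (Function.update x i t)))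
      (mixedDeriv (sqfreeIndex (insert i A)) f (WithLp.toLp 2 x)) (x i) := by
  have h : HasDerivAt _ _ _ := hf.hasLineDerivAt hi (WithLp.toLp 2 x)
  rw [← sub_self (x i)] at h
  have e : (fun t => mixedDeriv (sqfreeIndex A) f (WithLp.toLp 2 (Function.update x i t))) =
      fun t => mixedDeriv (sqfreeIndex A) f
        (WithLp.toLp 2 x + (t - x i) • EuclideanSpace.single i 1) := by
    funext t
    congr 1
    ext j
    rcases eq_or_ne j i with rfl | hj
    · simp
    · simp [hj]
  rw [e]
  exact h.comp_sub_const (x i) (x i)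

end HasGrowthRate

/-! ### The smooth cutoff -/

/-- A smooth function on the real line that is `1` on `(-∞, 0]` and `0` on `[1, ∞)`. -/
noncomputable def cutoff (t : ℝ) : ℝ := Real.smoothTransition (1 - t)

theorem contDiff_cutoff {n : ℕ∞} : ContDiff ℝ n cutoff :=
  Real.smoothTransition.contDiff.comp (contDiff_const.sub contDiff_id)

theorem cutoff_eq_one {t : ℝ} (ht : t ≤ 0) : cutoff t = 1 :=
  Real.smoothTransition.one_of_one_le (by linarith)

theorem hasDerivAt_iteratedDeriv_cutoff (m : ℕ) (t : ℝ) :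
    HasDerivAt (iteratedDeriv m cutoff) (iteratedDeriv (m + 1) cutoff t) t := by
  rw [iteratedDeriv_succ]
  exact ((contDiff_cutoff (n := ⊤)).differentiable_iteratedDeriv m
    (by exact_mod_cast WithTop.coe_lt_top _) t).hasDerivAt

theorem iteratedDeriv_cutoff_eq_zero (m : ℕ) {t : ℝ} (ht : 1 < t) :
    iteratedDeriv m cutoff t = 0 := by
  have h : cutoff =ᶠ[nhds t] fun _ => 0 := by
    filter_upwards [lt_mem_nhds ht] with s hs
    exact Real.smoothTransition.zero_of_nonpos (by linarith)
  rw [h.iteratedDeriv_eq m]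
  simp

theorem abs_iteratedDeriv_cutoff_le (m : ℕ) : ∃ C, ∀ t, |iteratedDeriv m cutoff t| ≤ C := by
  have hc : Continuous (iteratedDeriv m cutoff) :=
    (contDiff_cutoff (n := ⊤)).continuous_iteratedDeriv m (by exact_mod_cast le_top)
  obtain ⟨C, hC⟩ := (isCompact_Icc (a := (0 : ℝ)) (b := 1)).exists_bound_of_continuousOn
    hc.continuousOn
  refine ⟨max C 1, fun t => ?_⟩
  rcases lt_or_ge t 0 with h0 | h0
  · have h : cutoff =ᶠ[nhds t] fun _ => 1 := by
      filter_upwards [gt_mem_nhds h0] with s hs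
      exact cutoff_eq_one hs.le
    rw [h.iteratedDeriv_eq m, iteratedDeriv_const]
    split_ifs <;> simp
  · rcases lt_or_ge 1 t with h1 | h1
    · rw [iteratedDeriv_cutoff_eq_zero m h1]
      simp
    · exact (hC t ⟨h0, h1⟩).trans (le_max_left _ _)

/-! ### Truncation of a function of quadratic exponential growth -/

/-- The square-free mixed derivative, in the coordinates of `s`, of the product of a function with
the cutoff `cutoff (‖x‖² - ρ)`, written out by the Leibniz rule. Here `D A` stands for the mixed
derivative in the coordinates of `A` of the function. As every coordinate is
differentiated at most once, each derivative that falls on the cutoff contributes a factor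
`2 x_j`. -/
noncomputable def cutoffDeriv {d : ℕ} (D : Finset (Fin d) → (Fin d → ℝ) → ℝ) (ρ : ℝ)
    (s : Finset (Fin d)) (x : Fin d → ℝ) : ℝ :=
  ∑ A ∈ s.powerset, D A x * ((∏ j ∈ s \ A, 2 * x j) *
    iteratedDeriv (s \ A).card cutoff (∑ j, x j ^ 2 - ρ))

theorem hasDerivAt_sum_sq_update {d : ℕ} (ρ : ℝ) (i : Fin d) (x : Fin d → ℝ) :
    HasDerivAt (fun t => ∑ j, (Function.update x i t) j ^ 2 - ρ) (2 * x i) (x i) := by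
  have h : ∀ j ∈ Finset.univ, HasDerivAt (fun t => (Function.update x i t) j ^ 2)
      (if j = i then 2 * x i else 0) (x i) := by
    intro j _
    rcases eq_or_ne j i with rfl | hj
    · simpa using (hasDerivAt_id' (x j)).fun_pow 2
    · simpa [hj] using hasDerivAt_const (x i) (x j ^ 2)
  simpa using (HasDerivAt.fun_sum h).sub_const ρ

theorem hasDerivAt_cutoffDeriv {d : ℕ} {D : Finset (Fin d) → (Fin d → ℝ) → ℝ} (ρ : ℝ)
    {i : Fin d} (hD : ∀ A : Finset (Fin d), (∀ j ∈ A, i < j) → ∀ x,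
      HasDerivAt (fun t => D A (Function.update x i t)) (D (insert i A) x) (x i))
    {s : Finset (Fin d)} (hi : ∀ j ∈ s, i < j) (x : Fin d → ℝ) :
    HasDerivAt (fun t => cutoffDeriv D ρ s (Function.update x i t))
      (cutoffDeriv D ρ (insert i s) x) (x i) := by
  have his : i ∉ s := fun h => lt_irrefl i (hi i h)
  have hterm : ∀ A ∈ s.powerset, HasDerivAt (fun t => D A (Function.update x i t) *
      ((∏ j ∈ s \ A, 2 * (Function.update x i t) j) * iteratedDeriv (s \ A).card cutoff
        (∑ j, (Function.update x i t) j ^ 2 - ρ)))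
      (D A x * ((∏ j ∈ insert i s \ A, 2 * x j) *
          iteratedDeriv (insert i s \ A).card cutoff (∑ j, x j ^ 2 - ρ)) +
        D (insert i A) x * ((∏ j ∈ insert i s \ insert i A, 2 * x j) *
          iteratedDeriv (insert i s \ insert i A).card cutoff (∑ j, x j ^ 2 - ρ))) (x i) := by
    intro A hA
    rw [Finset.mem_powerset] at hA
    have hiA : i ∉ A := fun h => his (hA h)
    have hisA : i ∉ s \ A := fun h => his (Finset.sdiff_subset h)
    have e1 : insert i s \ insert i A = s \ A := by
      rw [Finset.insert_sdiff_insert, Finset.sdiff_insert, Finset.erase_eq_of_notMem hisA]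
    rw [Finset.insert_sdiff_of_notMem _ hiA, e1, Finset.prod_insert hisA,
      Finset.card_insert_of_notMem hisA]
    have e2 : ∀ t, ∏ j ∈ s \ A, 2 * (Function.update x i t) j = ∏ j ∈ s \ A, 2 * x j :=
      fun t => Finset.prod_congr rfl fun j hj => by
        have hne : j ≠ i := fun h => hisA (h ▸ hj)
        rw [Function.update_of_ne hne]
    simp only [e2]
    have h1 := hD A (fun j hj => hi j (hA hj)) x
    have h2 := (hasDerivAt_iteratedDeriv_cutoff (s \ A).card (∑ j, x j ^ 2 - ρ)).comp_of_eq (x i)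
      (hasDerivAt_sum_sq_update ρ i x) (by simp)
    refine (h1.fun_mul (h2.const_mul (∏ j ∈ s \ A, 2 * x j))).congr_deriv ?_
    simp only [Function.comp_apply, Function.update_eq_self]
    ring
  unfold cutoffDeriv
  rw [Finset.sum_powerset_insert his, ← Finset.sum_add_distrib]
  exact HasDerivAt.fun_sum hterm

theorem cutoffDeriv_empty {d : ℕ} (D : Finset (Fin d) → (Fin d → ℝ) → ℝ) (ρ : ℝ)
    (x : Fin d → ℝ) : cutoffDeriv D ρ ∅ x = D ∅ x * cutoff (∑ j, x j ^ 2 - ρ) := by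
  simp [cutoffDeriv]

theorem measurable_cutoffDeriv {d : ℕ} {D : Finset (Fin d) → (Fin d → ℝ) → ℝ}
    (hD : ∀ A, Measurable (D A)) (ρ : ℝ) (s : Finset (Fin d)) :
    Measurable (cutoffDeriv D ρ s) := by
  have hc : ∀ m, Measurable (iteratedDeriv m cutoff) := fun m =>
    ((contDiff_cutoff (n := ⊤)).continuous_iteratedDeriv m (by exact_mod_cast le_top)).measurable
  unfold cutoffDeriv
  refine Finset.measurable_sum _ fun A _ => (hD A).mul (Measurable.mul (by fun_prop) ?_)
  exact (hc _).comp (by fun_prop)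

theorem cutoffDeriv_eq_zero {d : ℕ} (D : Finset (Fin d) → (Fin d → ℝ) → ℝ) {ρ : ℝ}
    (s : Finset (Fin d)) {x : Fin d → ℝ} (hx : 1 < ∑ j, x j ^ 2 - ρ) :
    cutoffDeriv D ρ s x = 0 :=
  Finset.sum_eq_zero fun A _ => by rw [iteratedDeriv_cutoff_eq_zero _ hx]; simp

theorem cutoffDeriv_eq_zero_of_lt_abs {d : ℕ} (D : Finset (Fin d) → (Fin d → ℝ) → ℝ) {ρ : ℝ}
    (hρ : 0 ≤ ρ) (s : Finset (Fin d)) {x : Fin d → ℝ} (hx : ∃ j, ρ + 2 < |x j|) :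
    cutoffDeriv D ρ s x = 0 := by
  obtain ⟨j, hj⟩ := hx
  refine cutoffDeriv_eq_zero D s ?_
  have h1 : x j ^ 2 ≤ ∑ j, x j ^ 2 :=
    Finset.single_le_sum (f := fun j => x j ^ 2) (fun _ _ => sq_nonneg _) (Finset.mem_univ j)
  have h2 := sq_abs (x j)
  nlinarith

/-- A bound for the mixed derivatives of the truncated function that is polynomial in `ρ` up to the
growth of the function on the ball of radius `√(ρ + 1)`. -/
theorem abs_cutoffDeriv_le {d : ℕ} {D : Finset (Fin d) → (Fin d → ℝ) → ℝ} {c K : ℝ}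
    (hK : 0 ≤ K) (hD : ∀ A x, |D A x| ≤ c * Real.exp (K * ∑ j, x j ^ 2)) {C : ℝ}
    (hC : ∀ m ≤ d, ∀ t, |iteratedDeriv m cutoff t| ≤ C) {ρ : ℝ} (hρ : 0 ≤ ρ)
    (s : Finset (Fin d)) (x : Fin d → ℝ) :
    |cutoffDeriv D ρ s x| ≤
      2 ^ d * (c * Real.exp (K * (ρ + 1)) * ((2 * (ρ + 2)) ^ d * C)) := by
  have hc : 0 ≤ c := by
    have := (abs_nonneg _).trans (hD ∅ x)
    exact nonneg_of_mul_nonneg_left this (Real.exp_pos _)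
  have hC0 : 0 ≤ C := (abs_nonneg _).trans (hC 0 (Nat.zero_le _) 0)
  have hnn : 0 ≤ c * Real.exp (K * (ρ + 1)) * ((2 * (ρ + 2)) ^ d * C) := by positivity
  rcases lt_or_ge 1 (∑ j, x j ^ 2 - ρ) with hx | hx
  · rw [cutoffDeriv_eq_zero D s hx, abs_zero]
    positivity
  have hxj : ∀ j, |2 * x j| ≤ 2 * (ρ + 2) := by
    intro j
    have h1 : x j ^ 2 ≤ ∑ j, x j ^ 2 :=
      Finset.single_le_sum (f := fun j => x j ^ 2) (fun _ _ => sq_nonneg _) (Finset.mem_univ j)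
    rw [abs_mul, abs_two]
    have h2 := sq_abs (x j)
    nlinarith [sq_nonneg (|x j| - 1)]
  have hterm : ∀ A ∈ s.powerset, |D A x * ((∏ j ∈ s \ A, 2 * x j) *
      iteratedDeriv (s \ A).card cutoff (∑ j, x j ^ 2 - ρ))| ≤
      c * Real.exp (K * (ρ + 1)) * ((2 * (ρ + 2)) ^ d * C) := by
    intro A _
    have hcard : (s \ A).card ≤ d := by simpa using (s \ A).card_le_univ
    rw [abs_mul, abs_mul, Finset.abs_prod]
    refine mul_le_mul ((hD A x).trans ?_) (mul_le_mul ?_ (hC _ hcard _) (abs_nonneg _)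
      (by positivity)) (by positivity) (by positivity)
    · gcongr
      linarith
    · calc ∏ j ∈ s \ A, |2 * x j| ≤ ∏ _j ∈ s \ A, (2 * (ρ + 2)) :=
            Finset.prod_le_prod (fun _ _ => abs_nonneg _) fun j _ => hxj j
        _ = (2 * (ρ + 2)) ^ (s \ A).card := by rw [Finset.prod_const]
        _ ≤ (2 * (ρ + 2)) ^ d := pow_le_pow_right₀ (by linarith) hcard
  calc |cutoffDeriv D ρ s x| ≤ ∑ A ∈ s.powerset, _ := Finset.abs_sum_le_sum_abs _ _
    _ ≤ ∑ _A ∈ s.powerset, c * Real.exp (K * (ρ + 1)) * ((2 * (ρ + 2)) ^ d * C) :=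
        Finset.sum_le_sum hterm
    _ = 2 ^ s.card * (c * Real.exp (K * (ρ + 1)) * ((2 * (ρ + 2)) ^ d * C)) := by
        rw [Finset.sum_const, Finset.card_powerset, nsmul_eq_mul, Nat.cast_pow, Nat.cast_two]
    _ ≤ _ := by
        gcongr
        · norm_num
        · simpa using s.card_le_univ

theorem integral_abs_le_of_cube {n : ℕ} {F : (Fin n → ℝ) → ℝ} {B R : ℝ} (hR : 0 ≤ R)
    (hB : ∀ x, |F x| ≤ B) (hsupp : ∀ x, (∃ j, R < |x j|) → F x = 0) :
    ∫ x, |F x| ≤ B * (2 * R) ^ n := by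
  have hvol : volume (Set.Icc (fun _ : Fin n => -R) fun _ => R) = ENNReal.ofReal (2 * R) ^ n := by
    rw [Real.volume_Icc_pi]
    simp [two_mul]
  rw [← setIntegral_eq_integral_of_forall_compl_eq_zero
    (s := Set.Icc (fun _ : Fin n => -R) fun _ => R)]
  · refine (Real.le_norm_self _).trans
      ((norm_setIntegral_le_of_norm_le_const (C := B) ?_ ?_).trans ?_)
    · rw [hvol]; exact ENNReal.pow_lt_top ENNReal.ofReal_lt_top
    · intro x _; simpa using hB x
    · rw [Measure.real, hvol, ENNReal.toReal_pow, ENNReal.toReal_ofReal (by linarith)]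
  · intro x hx
    rw [hsupp x, abs_zero]
    by_contra! h
    exact hx ⟨fun j => (abs_le.1 (h j)).1, fun j => (abs_le.1 (h j)).2⟩

theorem exists_pow_le_exp (n : ℕ) {ε : ℝ} (hε : 0 < ε) :
    ∃ C, 0 ≤ C ∧ ∀ x, 0 ≤ x → (2 * (x + 2)) ^ n ≤ C * Real.exp (ε * x) := by
  have hn : (0 : ℝ) < n + 1 := by positivity
  refine ⟨(2 * ((n + 1) / ε + 2)) ^ n, by positivity, fun x hx => ?_⟩
  have h1 : x ≤ (n + 1) / ε * Real.exp (ε * x / (n + 1)) := by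
    have := Real.add_one_le_exp (ε * x / (n + 1))
    rw [div_mul_eq_mul_div, le_div_iff₀ hε]
    have h2 : ε * x / (n + 1) ≤ Real.exp (ε * x / (n + 1)) := by linarith
    rw [div_le_iff₀ hn] at h2
    linarith
  have h3 : 1 ≤ Real.exp (ε * x / (n + 1)) := Real.one_le_exp (by positivity)
  calc (2 * (x + 2)) ^ n
      ≤ (2 * ((n + 1) / ε + 2) * Real.exp (ε * x / (n + 1))) ^ n := by
        refine pow_le_pow_left₀ (by positivity) ?_ n
        nlinarith
    _ = (2 * ((n + 1) / ε + 2)) ^ n * Real.exp (n * (ε * x / (n + 1))) := by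
        rw [mul_pow, Real.exp_nat_mul]
    _ ≤ _ := by
        refine mul_le_mul_of_nonneg_left (Real.exp_le_exp.2 ?_) (by positivity)
        rw [← mul_div_assoc, div_le_iff₀ hn]
        nlinarith [mul_nonneg hε.le hx]

/-- The truncation step: for each `ρ`, the function `f` agrees on the ball of radius `√ρ` with a
function `h` that is the integral over upper orthants of a function `k`, whose `L¹` norm is
at most `exp (max M 0 * ρ)` up to subexponential factors. -/
theorem HasGrowthRate.exists_truncation {d : ℕ} {M : ℝ} {f : EuclideanSpace ℝ (Fin d) → ℝ}
    (hf : HasGrowthRate M f) {ε : ℝ} (hε : 0 < ε) :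
    ∃ C, ∀ ρ, 0 ≤ ρ → ∃ (h : EuclideanSpace ℝ (Fin d) → ℝ) (k : (Fin d → ℝ) → ℝ),
      Measurable h ∧ (∀ x, |f x - h x| ≤ {x | ρ < ‖x‖ ^ 2}.indicator (fun x => |f x|) x) ∧
      Integrable k ∧ (∀ x, h (WithLp.toLp 2 x) = (-1) ^ d * ∫ y in Set.Ici x, k y) ∧
      ∫ y, |k y| ≤ C * Real.exp ((max M 0 + ε) * ρ) := by
  set K := max M 0 with hK
  have hK0 : 0 ≤ K := le_max_right _ _
  let D : Finset (Fin d) → (Fin d → ℝ) → ℝ := fun A x =>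
    mixedDeriv (sqfreeIndex A) f (WithLp.toLp 2 x)
  have hnorm : ∀ x : EuclideanSpace ℝ (Fin d), ∑ j, x j ^ 2 = ‖x‖ ^ 2 := fun x => by
    simp [EuclideanSpace.norm_sq_eq]
  obtain ⟨c, hc⟩ : ∃ c, ∀ A x, |D A x| ≤ c * Real.exp (K * ∑ j, x j ^ 2) := by
    choose c hc using fun A : Finset (Fin d) => hf.bound (sqfreeIndex A) (sum_sqfreeIndex_le A)
    refine ⟨∑ A, |c A|, fun A x => (hc A _).trans ?_⟩
    have h1 : c A ≤ ∑ A, |c A| := (le_abs_self _).trans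
      (Finset.single_le_sum (f := fun A => |c A|) (fun _ _ => abs_nonneg _) (Finset.mem_univ A))
    refine mul_le_mul h1 ?_ (Real.exp_pos _).le (Finset.sum_nonneg fun _ _ => abs_nonneg _)
    rw [← hnorm]
    exact Real.exp_le_exp.2 (mul_le_mul_of_nonneg_right (le_max_left _ _)
      (Finset.sum_nonneg fun _ _ => sq_nonneg _))
  obtain ⟨C₁, hC₁⟩ : ∃ C, ∀ m ≤ d, ∀ t, |iteratedDeriv m cutoff t| ≤ C := by
    choose C hC using abs_iteratedDeriv_cutoff_le
    exact ⟨∑ m ∈ Finset.range (d + 1), C m, fun m hm t => (hC m t).trans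
      (Finset.single_le_sum (f := C) (fun m _ => (abs_nonneg _).trans (hC m 0))
        (Finset.mem_range.2 (Nat.lt_succ_of_le hm)))⟩
  have hc0 : 0 ≤ c := nonneg_of_mul_nonneg_left ((abs_nonneg _).trans (hc ∅ 0)) (Real.exp_pos _)
  have hC₁0 : 0 ≤ C₁ := (abs_nonneg _).trans (hC₁ 0 (Nat.zero_le _) 0)
  obtain ⟨C₂, hC₂0, hC₂⟩ := exists_pow_le_exp (d + d) hε
  have hDmeas : ∀ A, Measurable (D A) := fun A =>
    (hf.measurable_mixedDeriv A).comp (WithLp.measurable_toLp 2 (Fin d → ℝ))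
  refine ⟨2 ^ d * c * Real.exp K * C₁ * C₂, fun ρ hρ =>
    ⟨fun x => f x * cutoff (‖x‖ ^ 2 - ρ), cutoffDeriv D ρ Finset.univ, ?_, ?_, ?_, ?_, ?_⟩⟩
  · have := (contDiff_cutoff (n := 0)).continuous
    have := hf.continuous
    exact Continuous.measurable (by fun_prop)
  · intro x
    by_cases hx : ρ < ‖x‖ ^ 2
    · rw [Set.indicator_of_mem (by exact hx), ← mul_one_sub, abs_mul]
      refine mul_le_of_le_one_right (abs_nonneg _) (abs_le.2 ⟨?_, ?_⟩)
      · linarith [Real.smoothTransition.le_one (1 - (‖x‖ ^ 2 - ρ)),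
          show cutoff (‖x‖ ^ 2 - ρ) = Real.smoothTransition (1 - (‖x‖ ^ 2 - ρ)) from rfl]
      · linarith [Real.smoothTransition.nonneg (1 - (‖x‖ ^ 2 - ρ)),
          show cutoff (‖x‖ ^ 2 - ρ) = Real.smoothTransition (1 - (‖x‖ ^ 2 - ρ)) from rfl]
    · beta_reduce
      rw [Set.indicator_of_notMem (by exact hx), cutoff_eq_one (by linarith [not_lt.1 hx])]
      simp
  all_goals
    have hbc : ∀ s, IsBoundedCompact (cutoffDeriv D ρ s) := fun s =>
      ⟨measurable_cutoffDeriv hDmeas ρ s, ⟨_, abs_cutoffDeriv_le hK0 hc hC₁ hρ s⟩,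
        ⟨ρ + 2, fun x => cutoffDeriv_eq_zero_of_lt_abs D hρ s⟩⟩
  · exact (hbc _).integrable
  · intro x
    have h := eq_setIntegral_Ici_of_chain
      (fun m : Fin (d + 1) => cutoffDeriv D ρ {j | m ≤ j.castSucc}) (fun m => hbc _) ?_ x
    · have e1 : ({j | Fin.last d ≤ j.castSucc} : Finset (Fin d)) = ∅ := by
        ext j; simp [Fin.last_le_iff, Fin.castSucc_ne_last]
      have e2 : ({j | (0 : Fin (d + 1)) ≤ j.castSucc} : Finset (Fin d)) = Finset.univ := by
        ext j; simp
      rw [e1, e2, cutoffDeriv_empty] at h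
      beta_reduce
      rw [← h, ← hnorm]
      simp only [D, mixedDeriv_sqfreeIndex_empty]
    · intro m y
      have e : ({j | m.castSucc ≤ j.castSucc} : Finset (Fin d)) =
          insert m ({j | m.succ ≤ j.castSucc} : Finset (Fin d)) := by
        ext j
        simp only [Finset.mem_filter, Finset.mem_univ, true_and, Finset.mem_insert,
          Fin.castSucc_le_castSucc_iff, Fin.succ_le_castSucc_iff]
        rw [le_iff_eq_or_lt, eq_comm]
      rw [e]
      exact hasDerivAt_cutoffDeriv ρ (fun A hA x => hf.hasDerivAt_update hA x)
        (fun j hj => by simpa [Fin.succ_le_castSucc_iff] using hj) y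
  · refine (integral_abs_le_of_cube (R := ρ + 2) (by linarith)
      (abs_cutoffDeriv_le hK0 hc hC₁ hρ _)
      (fun x => cutoffDeriv_eq_zero_of_lt_abs D hρ _)).trans ?_
    have h := hC₂ ρ hρ
    calc _ = 2 ^ d * c * C₁ * Real.exp (K * (ρ + 1)) * (2 * (ρ + 2)) ^ (d + d) := by ring
      _ ≤ 2 ^ d * c * C₁ * Real.exp (K * (ρ + 1)) * (C₂ * Real.exp (ε * ρ)) := by gcongr
      _ = _ := by
        rw [mul_add, mul_one, Real.exp_add, add_mul, Real.exp_add]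
        ring

/-! ### Exponential moments from the sub-Gaussian tail -/

/-- Lowering the rate `α` absorbs the factor `t ^ η` and the range of small `t`. -/
theorem SubGaussianTail.exists_le_exp {d : ℕ} {T : (Fin d → ℝ) → EuclideanSpace ℝ (Fin d)}
    {α η : ℝ} (hT : SubGaussianTail T α η) {a : ℝ} (ha : a < α) (ha0 : 0 ≤ a) :
    ∃ C, ∀ t, 0 ≤ t → (uniformCube d).real {v | t < ‖T v‖} ≤ C * Real.exp (-a * t ^ 2) := by
  obtain ⟨t₀, c, -, h⟩ := hT
  have hlit := (rpow_mul_exp_neg_mul_sq_isLittleO_exp_neg (b := α - a) (by linarith) η).bound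
    one_pos
  obtain ⟨t₁, ht₁⟩ := Filter.eventually_atTop.1 hlit
  set r := max (max t₀ t₁) 0 + 1 with hr
  have hr0 : 0 ≤ r := by positivity
  refine ⟨max |c| (Real.exp (a * r ^ 2)), fun t ht => ?_⟩
  rcases lt_or_ge t r with htr | htr
  · calc (uniformCube d).real {v | t < ‖T v‖} ≤ 1 := measureReal_le_one
      _ ≤ Real.exp (a * r ^ 2) * Real.exp (-a * t ^ 2) := by
        rw [← Real.exp_add]
        refine Real.one_le_exp ?_
        have : t ^ 2 ≤ r ^ 2 := pow_le_pow_left₀ ht htr.le 2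
        nlinarith
      _ ≤ _ := by gcongr; exact le_max_right _ _
  · have h1 : t₀ ≤ max (max t₀ t₁) 0 := (le_max_left _ _).trans (le_max_left _ _)
    have h2 : t₁ ≤ max (max t₀ t₁) 0 := (le_max_right _ _).trans (le_max_left _ _)
    have h3 := ht₁ t (by linarith)
    have h4 : t ^ η * Real.exp (-(α - a) * t ^ 2) ≤ 1 := by
      refine (Real.le_norm_self _).trans (h3.trans ?_)
      rw [one_mul, Real.norm_of_nonneg (Real.exp_pos _).le]
      exact Real.exp_le_one_iff.2 (by linarith)
    calc (uniformCube d).real {v | t < ‖T v‖} ≤ c * (t ^ η * Real.exp (-α * t ^ 2)) :=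
          h t (by linarith)
      _ = c * (t ^ η * Real.exp (-(α - a) * t ^ 2) * Real.exp (-a * t ^ 2)) := by
        rw [mul_assoc (t ^ η), ← Real.exp_add]; ring_nf
      _ ≤ |c| * (1 * Real.exp (-a * t ^ 2)) :=
        mul_le_mul (le_abs_self c) (mul_le_mul_of_nonneg_right h4 (Real.exp_pos _).le)
          (by positivity) (abs_nonneg c)
      _ ≤ _ := by rw [one_mul]; gcongr; exact le_max_left _ _

theorem SubGaussianTail.integrable_exp {d : ℕ} {T : (Fin d → ℝ) → EuclideanSpace ℝ (Fin d)}
    {α η : ℝ} (hT : SubGaussianTail T α η) (hTm : AEMeasurable T (uniformCube d)) {β : ℝ}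
    (hβ0 : 0 ≤ β) (hβ : β < α) :
    Integrable (fun v => Real.exp (β * ‖T v‖ ^ 2)) (uniformCube d) := by
  obtain ⟨a, hβa, haα⟩ := exists_between hβ
  obtain ⟨C, hC⟩ := hT.exists_le_exp haα (hβ0.trans hβa.le)
  have hYm : AEMeasurable (fun v => ‖T v‖ ^ 2) (uniformCube d) := hTm.norm.pow_const 2
  refine ⟨(Real.measurable_exp.comp_aemeasurable (hYm.const_mul β)).aestronglyMeasurable, ?_⟩
  rw [hasFiniteIntegral_iff_ofReal (ae_of_all _ fun _ => (Real.exp_pos _).le)]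
  -- Decompose according to the integer part of `‖T v‖ ^ 2`.
  let φ : ℕ → (Fin d → ℝ) → ENNReal := fun n v =>
    ENNReal.ofReal (Real.exp (β * (n + 1))) *
      (Set.Ioi (n : ℝ)).indicator 1 (‖T v‖ ^ 2)
  have hφm : ∀ n : ℕ, AEMeasurable
      (fun v => (Set.Ioi (n : ℝ)).indicator (1 : ℝ → ENNReal) (‖T v‖ ^ 2)) (uniformCube d) := fun n =>
    (measurable_one.indicator measurableSet_Ioi).comp_aemeasurable hYm
  have hpt : ∀ v, ENNReal.ofReal (Real.exp (β * ‖T v‖ ^ 2)) ≤ 1 + ∑' n, φ n v := by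
    intro v
    rcases hm : ⌈‖T v‖ ^ 2⌉₊ with _ | n
    · have : ‖T v‖ ^ 2 ≤ 0 := Nat.ceil_eq_zero.1 hm
      refine le_trans ?_ le_self_add
      rw [ENNReal.ofReal_le_one]
      exact Real.exp_le_one_iff.2 (mul_nonpos_of_nonneg_of_nonpos hβ0 this)
    · have h1 : ‖T v‖ ^ 2 ≤ n + 1 := by
        have := Nat.le_ceil (‖T v‖ ^ 2)
        rw [hm] at this
        exact_mod_cast this
      have h2 : (n : ℝ) < ‖T v‖ ^ 2 := Nat.lt_ceil.1 (by omega)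
      refine le_trans ?_ ((ENNReal.le_tsum n).trans le_add_self)
      simp only [φ]
      rw [Set.indicator_of_mem (by exact h2), Pi.one_apply, mul_one]
      exact ENNReal.ofReal_le_ofReal (Real.exp_le_exp.2 (mul_le_mul_of_nonneg_left h1 hβ0))
  have hint : ∀ n : ℕ, ∫⁻ v, φ n v ∂(uniformCube d) ≤
      ENNReal.ofReal (C * Real.exp β * Real.exp (β - a) ^ n) := by
    intro n
    have hset : ∀ v, (Set.Ioi (n : ℝ)).indicator (1 : ℝ → ENNReal) (‖T v‖ ^ 2) =
        {v | √(n : ℝ) < ‖T v‖}.indicator 1 v := by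
      intro v
      have : v ∈ {v | √(n : ℝ) < ‖T v‖} ↔ ‖T v‖ ^ 2 ∈ Set.Ioi (n : ℝ) :=
        Real.sqrt_lt (Nat.cast_nonneg n) (norm_nonneg _)
      by_cases hv : ‖T v‖ ^ 2 ∈ Set.Ioi (n : ℝ)
      · rw [Set.indicator_of_mem hv, Set.indicator_of_mem (this.2 hv)]; rfl
      · rw [Set.indicator_of_notMem hv, Set.indicator_of_notMem (mt this.1 hv)]
    have hnull : NullMeasurableSet {v | √(n : ℝ) < ‖T v‖} (uniformCube d) :=
      nullMeasurableSet_lt aemeasurable_const hTm.norm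
    simp only [φ]
    rw [lintegral_const_mul'' _ (hφm n)]
    simp only [hset]
    rw [lintegral_indicator_one₀ hnull, ← ofReal_measureReal,
      ← ENNReal.ofReal_mul (Real.exp_pos _).le]
    refine ENNReal.ofReal_le_ofReal ?_
    calc _ ≤ Real.exp (β * (n + 1)) * (C * Real.exp (-a * √(n : ℝ) ^ 2)) := by
          gcongr; exact hC _ (Real.sqrt_nonneg _)
      _ = C * (Real.exp (β * (n + 1)) * Real.exp (-a * √(n : ℝ) ^ 2)) := by ring
      _ = _ := by
        rw [mul_assoc C, Real.sq_sqrt (Nat.cast_nonneg n), ← Real.exp_nat_mul, ← Real.exp_add,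
          ← Real.exp_add]
        ring_nf
  have hsum : Summable fun n : ℕ => C * Real.exp β * Real.exp (β - a) ^ n :=
    (summable_geometric_of_lt_one (Real.exp_pos _).le
      (Real.exp_lt_one_iff.2 (by linarith))).mul_left _
  calc ∫⁻ v, ENNReal.ofReal (Real.exp (β * ‖T v‖ ^ 2)) ∂(uniformCube d)
      ≤ ∫⁻ v, 1 + ∑' n, φ n v ∂(uniformCube d) := lintegral_mono hpt
    _ = 1 + ∑' n, ∫⁻ v, φ n v ∂(uniformCube d) := by
      rw [lintegral_add_left measurable_const, lintegral_tsum fun n => (hφm n).const_mul _,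
        lintegral_one, measure_univ]
    _ ≤ 1 + ∑' n : ℕ, ENNReal.ofReal (C * Real.exp β * Real.exp (β - a) ^ n) := by
      gcongr with n; exact hint n
    _ < ⊤ := by
      rw [ENNReal.add_lt_top]
      exact ⟨ENNReal.one_lt_top, hsum.tsum_ofReal_lt_top⟩

/-! ### Moments of the estimator -/

section Estimator

variable {Ω : Type*} [MeasurableSpace Ω] {P : Measure Ω} {d N : ℕ}
  {T : (Fin d → ℝ) → EuclideanSpace ℝ (Fin d)} {F : EuclideanSpace ℝ (Fin d) → ℝ}
  {q : ENNReal}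

theorem aestronglyMeasurable_estimator {w : Fin N → Ω → Fin d → ℝ}
    (hw : ∀ i, HasLaw (w i) (uniformCube d) P)
    (hF : AEStronglyMeasurable (fun v => F (T v)) (uniformCube d)) :
    AEStronglyMeasurable (fun ω => estimator T F (fun i => w i ω)) P := by
  unfold estimator
  refine AEStronglyMeasurable.const_mul (Finset.aestronglyMeasurable_fun_sum _ fun i _ => ?_) _
  exact AEStronglyMeasurable.comp_aemeasurable (g := fun v => F (T v))
    (by rw [(hw i).map_eq]; exact hF) (hw i).aemeasurable

/-- As every point is uniformly distributed, Minkowski's inequality bounds the moments of the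
estimator by those of the integrand, whatever the dependence between the points. -/
theorem eLpNorm_estimator_le {w : Fin N → Ω → Fin d → ℝ}
    (hw : ∀ i, HasLaw (w i) (uniformCube d) P)
    (hF : AEStronglyMeasurable (fun v => F (T v)) (uniformCube d)) (hq : 1 ≤ q) (hN : 1 ≤ N) :
    eLpNorm (fun ω => estimator T F (fun i => w i ω)) q P ≤
      eLpNorm (fun v => F (T v)) q (uniformCube d) := by
  have hmeas : ∀ i, AEStronglyMeasurable (fun ω => F (T (w i ω))) P := fun i =>
    AEStronglyMeasurable.comp_aemeasurable (g := fun v => F (T v))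
      (by rw [(hw i).map_eq]; exact hF) (hw i).aemeasurable
  have heq : ∀ i, eLpNorm (fun ω => F (T (w i ω))) q P =
      eLpNorm (fun v => F (T v)) q (uniformCube d) := fun i => by
    rw [← (hw i).map_eq, eLpNorm_map_measure (by rw [(hw i).map_eq]; exact hF)
      (hw i).aemeasurable]
    rfl
  have hfun : (fun ω => estimator T F (fun i => w i ω)) =
      (1 / (N : ℝ)) • ∑ i, fun ω => F (T (w i ω)) := by
    funext ω
    simp [estimator]
  have hN0 : (N : ENNReal) ≠ 0 := by exact_mod_cast (by omega : N ≠ 0)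
  rw [hfun, eLpNorm_const_smul]
  calc _ ≤ ‖(1 / (N : ℝ))‖ₑ * ∑ i, eLpNorm (fun ω => F (T (w i ω))) q P := by
        gcongr
        exact eLpNorm_sum_le (fun i _ => hmeas i) hq
    _ = (N : ENNReal)⁻¹ * (N * eLpNorm (fun v => F (T v)) q (uniformCube d)) := by
        have : ‖(1 / (N : ℝ))‖ₑ = (N : ENNReal)⁻¹ := by
          rw [one_div, enorm_inv (by exact_mod_cast (by omega : N ≠ 0))]
          simp
        simp only [this, heq, Finset.sum_const, Finset.card_univ, Fintype.card_fin, nsmul_eq_mul]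
    _ = _ := by
        rw [← mul_assoc, ENNReal.inv_mul_cancel hN0 (ENNReal.natCast_ne_top N), one_mul]

theorem enorm_targetMean_le (hF : AEStronglyMeasurable (fun v => F (T v)) (uniformCube d))
    (hq : 1 ≤ q) : ‖targetMean T F‖ₑ ≤ eLpNorm (fun v => F (T v)) q (uniformCube d) := by
  refine (enorm_integral_le_lintegral_enorm _).trans ?_
  rw [← eLpNorm_one_eq_lintegral_enorm]
  exact eLpNorm_le_eLpNorm_of_exponent_le hq hF

/-- The moments of the error are at most twice those of the integrand. -/
theorem eLpNorm_error_le [IsProbabilityMeasure P] {w : Fin N → Ω → Fin d → ℝ}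
    (hw : ∀ i, HasLaw (w i) (uniformCube d) P)
    (hF : AEStronglyMeasurable (fun v => F (T v)) (uniformCube d)) (hq : 1 ≤ q) (hN : 1 ≤ N) :
    eLpNorm (fun ω => estimator T F (fun i => w i ω) - targetMean T F) q P ≤
      2 * eLpNorm (fun v => F (T v)) q (uniformCube d) := by
  refine (eLpNorm_sub_le (aestronglyMeasurable_estimator hw hF) aestronglyMeasurable_const
    hq).trans ?_
  rw [two_mul]
  refine add_le_add (eLpNorm_estimator_le hw hF hq hN) ?_
  rw [eLpNorm_const _ (by positivity) (NeZero.ne P), measure_univ, ENNReal.one_rpow, mul_one]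
  exact enorm_targetMean_le hF hq

end Estimator

/-! ### The rate of convergence -/

/-- The error for `f` is bounded by the Koksma-Hlawka bound for an approximation `h`, which
has the representation required there, plus twice the moment of `f - h`. -/
theorem eLpNorm_error_le_of_truncation {Ω : Type*} [MeasurableSpace Ω] {P : Measure Ω}
    [IsProbabilityMeasure P] {d N : ℕ} {g : Fin d → ℝ → ℝ} (hg : ∀ j, IsDensity (g j))
    {w : Fin N → Ω → Fin d → ℝ} (hw : ∀ i, HasLaw (w i) (uniformCube d) P) {q : ENNReal}
    (hq : 1 ≤ q) (hN : 1 ≤ N) {f h : EuclideanSpace ℝ (Fin d) → ℝ}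
    (hf : Integrable (fun v => f (invMap g v)) (uniformCube d))
    (hhm : AEStronglyMeasurable (fun v => h (invMap g v)) (uniformCube d))
    {k : (Fin d → ℝ) → ℝ} (hk : Integrable k) (s : ℝ) (hs : |s| = 1)
    (hh : ∀ x, h (WithLp.toLp 2 x) = s * ∫ y in Set.Ici x, k y) {D : ℝ}
    (hD : ∀ᵐ ω ∂P, starDiscrepancy (fun i => w i ω) ≤ D) :
    eLpNorm (fun ω => estimator (invMap g) f (fun i => w i ω) - targetMean (invMap g) f) q P ≤
      ENNReal.ofReal (D * ∫ y, |k y|) +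
        2 * eLpNorm (fun v => f (invMap g v) - h (invMap g v)) q (uniformCube d) := by
  have hdiffm : AEStronglyMeasurable (fun v => f (invMap g v) - h (invMap g v))
      (uniformCube d) := hf.aestronglyMeasurable.sub hhm
  -- `h` is bounded by the `L¹` norm of `k`.
  have hhint : Integrable (fun v => h (invMap g v)) (uniformCube d) := by
    refine Integrable.of_bound hhm (∫ y, |k y|) (ae_of_all _ fun v => ?_)
    rw [invMap, hh, norm_mul, Real.norm_eq_abs, hs, one_mul]
    exact (norm_integral_le_integral_norm _).trans
      (setIntegral_le_integral hk.norm (ae_of_all _ fun y => norm_nonneg _))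
  have hsplit : (fun ω => estimator (invMap g) f (fun i => w i ω) - targetMean (invMap g) f) =
      (fun ω => estimator (invMap g) h (fun i => w i ω) - targetMean (invMap g) h) +
      fun ω => estimator (invMap g) (fun x => f x - h x) (fun i => w i ω) -
        targetMean (invMap g) (fun x => f x - h x) := by
    funext ω
    simp only [Pi.add_apply, estimator, targetMean, Finset.sum_sub_distrib]
    rw [integral_sub hf hhint]
    ring
  have hQMC : eLpNorm (fun ω => estimator (invMap g) h (fun i => w i ω) -
      targetMean (invMap g) h) q P ≤ ENNReal.ofReal (D * ∫ y, |k y|) := by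
    have hcube : ∀ᵐ ω ∂P, ∀ i, w i ω ∈ unitCube d := by
      refine ae_all_iff.2 fun i => ?_
      have := ae_mem_unitCube d
      rw [← (hw i).map_eq] at this
      exact ae_of_ae_map (hw i).aemeasurable this
    refine (eLpNorm_le_of_ae_bound (C := D * ∫ y, |k y|) ?_).trans (by simp)
    filter_upwards [hD, hcube] with ω hω hω'
    exact (koksma_hlawka_invMap hg hk s hs hh _ hω').trans
      (mul_le_mul_of_nonneg_right hω (integral_nonneg fun y => abs_nonneg _))
  rw [hsplit]
  refine (eLpNorm_add_le ((aestronglyMeasurable_estimator hw hhm).sub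
    aestronglyMeasurable_const) ((aestronglyMeasurable_estimator hw hdiffm).sub
    aestronglyMeasurable_const) hq).trans ?_
  exact add_le_add hQMC (eLpNorm_error_le hw hdiffm hq hN)

/-- The common form of both rates. If `exp (β ‖X‖²)` has a finite `p`-th moment, where
`β = τ + M` with `τ > 0`, then truncation at `‖x‖² = ρ` costs `exp (-τ ρ)`, and the truncated
function has variation `exp (max M 0 * ρ)` up to subexponential factors. The two errors are
balanced at `ρ = log N / (τ + max M 0)`. -/
theorem lpErrorIsBigO_of_memLp {Ω : Type*} [MeasurableSpace Ω] {P : Measure Ω}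
    [IsProbabilityMeasure P] {d : ℕ} {S : Set ℕ} {u : (N : ℕ) → Fin N → Ω → Fin d → ℝ}
    (hu : IsRQMCFamily P S u) {g : Fin d → ℝ → ℝ} (hg : ∀ j, IsDensity (g j))
    {p : ℝ} (hp : 1 ≤ p) {M : ℝ} {f : EuclideanSpace ℝ (Fin d) → ℝ} (hf : HasGrowthRate M f)
    {τ : ℝ} (hτ : 0 < τ)
    (hW : MemLp (fun v => Real.exp ((τ + M) * ‖invMap g v‖ ^ 2)) (ENNReal.ofReal p)
      (uniformCube d)) {ε : ℝ} (hε : 0 < ε) :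
    LpErrorIsBigO P S u (invMap g) f p (-(τ / (τ + max M 0)) + ε) := by
  set T := invMap g with hT
  set q := ENNReal.ofReal p with hq
  set K := max M 0 with hK
  have hp0 : 0 < p := by linarith
  have hq1 : 1 ≤ q := ENNReal.one_le_ofReal.2 hp
  have hK0 : 0 ≤ K := le_max_right _ _
  have hτK : 0 < τ + K := by linarith
  have hTm : AEMeasurable T (uniformCube d) := aemeasurable_invMap hg
  set W : (Fin d → ℝ) → ℝ := fun v => Real.exp ((τ + M) * ‖T v‖ ^ 2) with hWdef
  set A := (eLpNorm W q (uniformCube d)).toReal with hA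
  have hWA : eLpNorm W q (uniformCube d) = ENNReal.ofReal A :=
    (ENNReal.ofReal_toReal hW.eLpNorm_ne_top).symm
  have hA0 : 0 ≤ A := ENNReal.toReal_nonneg
  obtain ⟨c, hc⟩ := hf.bound (sqfreeIndex ∅) (sum_sqfreeIndex_le ∅)
  rw [mixedDeriv_sqfreeIndex_empty] at hc
  have hc0 : 0 ≤ c := nonneg_of_mul_nonneg_left ((abs_nonneg _).trans (hc 0)) (Real.exp_pos _)
  have hfm : AEStronglyMeasurable (fun v => f (T v)) (uniformCube d) :=
    (hf.continuous.measurable.comp_aemeasurable hTm).aestronglyMeasurable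
  -- `‖x‖ ^ 2 ≥ ρ` gives `exp (M ‖x‖ ^ 2) ≤ exp (-τ ρ) * exp ((τ + M) ‖x‖ ^ 2)`.
  have htail : ∀ ρ x, ρ ≤ ‖x‖ ^ 2 →
      |f x| ≤ c * Real.exp (-τ * ρ) * Real.exp ((τ + M) * ‖x‖ ^ 2) := by
    intro ρ x hx
    refine (hc x).trans ?_
    rw [mul_assoc, ← Real.exp_add]
    refine mul_le_mul_of_nonneg_left (Real.exp_le_exp.2 ?_) hc0
    nlinarith
  have hfA : eLpNorm (fun v => f (T v)) q (uniformCube d) ≤ ENNReal.ofReal (c * A) := by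
    rw [ENNReal.ofReal_mul hc0, ← hWA]
    refine eLpNorm_le_mul_eLpNorm_of_ae_le_mul (ae_of_all _ fun v => ?_) q
    rw [Real.norm_of_nonneg (Real.exp_pos _).le]
    simpa using htail 0 (T v) (sq_nonneg _)
  have hfL : MemLp (fun v => f (T v)) q (uniformCube d) :=
    ⟨hfm, hfA.trans_lt ENNReal.ofReal_lt_top⟩
  obtain ⟨C, hC⟩ := hf.exists_truncation (ε := ε * (τ + K) / 2) (by positivity)
  obtain ⟨c', hc'⟩ := hu.lowDiscrepancy
  obtain ⟨C₂, hC₂0, hC₂⟩ := exists_pow_le_exp (d - 1) (half_pos hε)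
  have hC0 : 0 ≤ C := by
    obtain ⟨_, k, -, -, -, -, hk⟩ := hC 0 le_rfl
    exact nonneg_of_mul_nonneg_left ((integral_nonneg fun y => abs_nonneg _).trans hk)
      (Real.exp_pos _)
  have key : ∀ N ∈ S, 1 ≤ N →
      eLpNorm (fun ω => estimator T f (fun i => u N i ω) - targetMean T f) q P ≤
        ENNReal.ofReal ((2 * c * A + |c'| * C * C₂) *
          (N : ℝ) ^ (-(τ / (τ + K)) + ε)) := by
    intro N hN hN1
    have hlaw := hu.uniform N hN
    have h2 : ∀ x, 2 * ENNReal.ofReal x = ENNReal.ofReal (2 * x) := fun x => by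
      rw [ENNReal.ofReal_mul (by norm_num)]; simp
    rcases eq_or_lt_of_le hN1 with rfl | hN2
    · refine (eLpNorm_error_le hlaw hfm hq1 le_rfl).trans ?_
      calc _ ≤ 2 * ENNReal.ofReal (c * A) := by gcongr
        _ = ENNReal.ofReal (2 * (c * A)) := h2 _
        _ ≤ _ := by
          refine ENNReal.ofReal_le_ofReal ?_
          rw [Nat.cast_one, Real.one_rpow, mul_one]
          have : 0 ≤ |c'| * C * C₂ := by positivity
          linarith
    have hNpos : (0 : ℝ) < N := by exact_mod_cast hN1
    set l := Real.log N with hl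
    have hl0 : 0 ≤ l := Real.log_nonneg (by exact_mod_cast hN1)
    have hNl : ∀ s : ℝ, (N : ℝ) ^ s = Real.exp (s * l) := fun s => by
      rw [Real.rpow_def_of_pos hNpos, mul_comm]
    set ρ := l / (τ + K) with hρ
    obtain ⟨h, k, hhm, hfh, hki, hhk, hkC⟩ := hC ρ (by positivity)
    have hhTm : AEStronglyMeasurable (fun v => h (T v)) (uniformCube d) :=
      (hhm.comp_aemeasurable hTm).aestronglyMeasurable
    have hdiff : eLpNorm (fun v => f (T v) - h (T v)) q (uniformCube d) ≤
        ENNReal.ofReal (c * Real.exp (-τ * ρ) * A) := by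
      rw [ENNReal.ofReal_mul (by positivity), ← hWA]
      refine eLpNorm_le_mul_eLpNorm_of_ae_le_mul (ae_of_all _ fun v => ?_) q
      rw [Real.norm_of_nonneg (Real.exp_pos _).le, Real.norm_eq_abs]
      refine (hfh (T v)).trans ?_
      by_cases hv : ρ < ‖T v‖ ^ 2
      · rw [Set.indicator_of_mem (by exact hv)]
        exact htail ρ (T v) hv.le
      · rw [Set.indicator_of_notMem (by exact hv)]
        positivity
    have hD : ∀ᵐ ω ∂P, starDiscrepancy (fun i => u N i ω) ≤ |c'| * ((N : ℝ)⁻¹ * l ^ (d - 1)) := by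
      filter_upwards [hc'] with ω hω
      exact (hω N hN hN2).trans (mul_le_mul_of_nonneg_right (le_abs_self c') (by positivity))
    refine (eLpNorm_error_le_of_truncation hg hlaw hq1 hN1 (hfL.integrable hq1) hhTm hki
      ((-1) ^ d) (by simp) hhk hD).trans ?_
    refine (add_le_add (ENNReal.ofReal_le_ofReal (mul_le_mul_of_nonneg_left hkC
      (by positivity))) (mul_le_mul_right hdiff 2)).trans ?_
    rw [h2, ← ENNReal.ofReal_add (by positivity) (by positivity)]
    refine ENNReal.ofReal_le_ofReal ?_
    have e1 : Real.exp (-τ * ρ) ≤ (N : ℝ) ^ (-(τ / (τ + K)) + ε) := by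
      rw [hNl, hρ]
      refine Real.exp_le_exp.2 ?_
      have : -τ * (l / (τ + K)) = -(τ / (τ + K)) * l := by ring
      rw [this]
      nlinarith
    have e2 : (N : ℝ)⁻¹ * Real.exp (ε / 2 * l) * Real.exp ((K + ε * (τ + K) / 2) * ρ) =
        (N : ℝ) ^ (-(τ / (τ + K)) + ε) := by
      rw [← Real.rpow_neg_one, hNl, hNl, ← Real.exp_add, ← Real.exp_add, hρ]
      congr 1
      field_simp
      ring
    have e3 : l ^ (d - 1) ≤ C₂ * Real.exp (ε / 2 * l) :=
      (pow_le_pow_left₀ hl0 (by linarith) _).trans (hC₂ l hl0)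
    calc _ ≤ |c'| * ((N : ℝ)⁻¹ * (C₂ * Real.exp (ε / 2 * l))) *
          (C * Real.exp ((K + ε * (τ + K) / 2) * ρ)) +
          2 * (c * (N : ℝ) ^ (-(τ / (τ + K)) + ε) * A) := by gcongr
      _ = |c'| * C * C₂ * ((N : ℝ)⁻¹ * Real.exp (ε / 2 * l) *
          Real.exp ((K + ε * (τ + K) / 2) * ρ)) +
          2 * c * A * (N : ℝ) ^ (-(τ / (τ + K)) + ε) := by ring
      _ = _ := by rw [e2]; ring
  refine ⟨hfL.integrable hq1, 2 * c * A + |c'| * C * C₂, fun N hN hN1 => ?_⟩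
  have hq0 : q ≠ 0 := (zero_lt_one.trans_le hq1).ne'
  have hqp : q.toReal = p := ENNReal.toReal_ofReal hp0.le
  have hmem : MemLp (fun ω => estimator T f (fun i => u N i ω) - targetMean T f) q P :=
    ⟨(aestronglyMeasurable_estimator (hu.uniform N hN) hfm).sub aestronglyMeasurable_const,
      (key N hN hN1).trans_lt ENNReal.ofReal_lt_top⟩
  refine ⟨by simpa [hqp] using hmem.integrable_norm_rpow hq0 ENNReal.ofReal_ne_top, ?_⟩
  have hk := key N hN hN1
  rw [hmem.eLpNorm_eq_integral_rpow_norm hq0 ENNReal.ofReal_ne_top, hqp,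
    ENNReal.ofReal_le_ofReal_iff (by positivity)] at hk
  simpa [one_div] using hk

end RQMC

theorem mainTheorem2 {Ω : Type*} [MeasurableSpace Ω] (P : MeasureTheory.Measure Ω)
    [MeasureTheory.IsProbabilityMeasure P] (d : ℕ) (hd : 1 ≤ d) (S : Set ℕ)
    (u : (N : ℕ) → Fin N → Ω → Fin d → ℝ) (hu : RQMC.IsRQMCFamily P S u)
    (g : Fin d → ℝ → ℝ) (hg : ∀ j, RQMC.IsDensity (g j))
    (p : ℝ) (hp : 1 ≤ p) (M : ℝ) (f : EuclideanSpace ℝ (Fin d) → ℝ)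
    (hf : RQMC.HasGrowthRate M f) :
    (M < 0 → ∀ ε > 0, RQMC.LpErrorIsBigO P S u (RQMC.invMap g) f p (-1 + ε)) ∧
    (∀ α η : ℝ, 0 < α → RQMC.SubGaussianTail (RQMC.invMap g) α η → 0 ≤ M → M < α / p →
      (∀ ε > 0, RQMC.LpErrorIsBigO P S u (RQMC.invMap g) f p (-(1 - p * M / α) + ε)) ∧
      (M < α / (2 * p) → 1 - p * M / α > 1 / 2)) := by
  have hp0 : 0 < p := by linarith
  constructor
  · intro hM ε hε
    have h := RQMC.lpErrorIsBigO_of_memLp hu hg hp hf (τ := -M) (by linarith)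
      (by simpa using memLp_const (1 : ℝ)) hε
    rwa [max_eq_right hM.le, add_zero, div_self (by linarith)] at h
  · intro α η hα hT hM hMα
    refine ⟨fun ε hε => ?_, fun h => ?_⟩
    · -- The exponential moment is finite only for `β < α`; half of `ε` pays for `α - β`.
      have hpM : p * M < α := by rw [lt_div_iff₀ hp0] at hMα; linarith
      have hcont : Filter.Tendsto (fun β => p * M / β) (nhdsWithin α (Set.Iio α))
          (nhds (p * M / α)) :=
        (tendsto_const_nhds.div Filter.tendsto_id hα.ne').mono_left nhdsWithin_le_nhds
      obtain ⟨β, hβ, hβM, hβα⟩ := ((hcont.eventually (gt_mem_nhds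
        (show p * M / α < p * M / α + ε / 2 by linarith))).and
          (Ioo_mem_nhdsLT hpM)).exists
      have hβ0 : 0 < β := lt_of_le_of_lt (by positivity) hβM
      have hint := hT.integrable_exp (RQMC.aemeasurable_invMap hg) hβ0.le hβα
      have hτ : 0 < β / p - M := by
        rw [sub_pos, lt_div_iff₀ hp0]; linarith
      have hW : MemLp (fun v => Real.exp ((β / p - M + M) * ‖RQMC.invMap g v‖ ^ 2))
          (ENNReal.ofReal p) (RQMC.uniformCube d) := by
        have hm : AEStronglyMeasurable
            (fun v => Real.exp ((β / p - M + M) * ‖RQMC.invMap g v‖ ^ 2))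
            (RQMC.uniformCube d) :=
          (Real.measurable_exp.comp_aemeasurable
            (((RQMC.aemeasurable_invMap hg).norm.pow_const 2).const_mul _)).aestronglyMeasurable
        rw [← integrable_norm_rpow_iff hm (by simpa using hp0) ENNReal.ofReal_ne_top,
          ENNReal.toReal_ofReal hp0.le]
        refine hint.congr (ae_of_all _ fun v => ?_)
        simp only [Real.norm_of_nonneg (Real.exp_pos _).le]
        rw [← Real.exp_mul]
        congr 1
        field_simp
        ring
      have h := RQMC.lpErrorIsBigO_of_memLp hu hg hp hf hτ hW (half_pos hε)
      rw [max_eq_left hM, sub_add_cancel] at h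
      obtain ⟨h1, C, hC⟩ := h
      refine ⟨h1, |C|, fun N hN hN1 => ⟨(hC N hN hN1).1, (hC N hN hN1).2.trans ?_⟩⟩
      refine mul_le_mul (le_abs_self C) (Real.rpow_le_rpow_of_exponent_le
        (by exact_mod_cast hN1) ?_) (by positivity) (abs_nonneg C)
      have : (β / p - M) / (β / p) = 1 - p * M / β := by field_simp
      rw [this]
      linarith
    · rw [lt_div_iff₀ (by positivity)] at h
      have : p * M / α < 1 / 2 := by
        rw [div_lt_div_iff₀ hα two_pos]; linarith
      linarith
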